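/- Consider the single-input system $x_{t+1}=Ax_t+Bu_t$, $x_t\in\mathbb R^N$, with $(A,B)$ stabilizable and $A=\mathrm{diag}(J_1,\dots,J_d)$ in real Jordan canonical form. Here $\lambda_1,\dots,\lambda_d$ are the distinct eigenvalues of $A$ (one from each complex conjugate pair), ordered so that $|\lambda_1|\ge\dots\ge|\lambda_d|\ge 1$, and $J_i$ is the block of $\lambda_i$, of size $\mu_i=m_i$ if $\lambda_i$ is real and $\mu_i=2m_i$ otherwise, where $m_i\geq 1$ is the algebraic multiplicity of $\lambda_i$. The initial state satisfies $x_0\sim N(0,\Sigma)$ with $\Sigma$ positive definite. The channel is $r_t=\gamma_ts_t+n_t$, where $\Pr(\gamma_t=0)=\epsilon$, $\Pr(\gamma_t=1)=1-\epsilon$, $\epsilon\in[0,1]$, and $n_t\sim N(0,\sigma_n^2)$ with $\sigma_n^2>0$; the variables $x_0,\gamma_0,n_0,\gamma_1,n_1,\dots$ are independent. The channel input must satisfy $\mathbb E[s_t^2]\le P$, where $P>0$. Put $\delta=\sigma_n^2/(\sigma_n^2+P)$. The encoder is causal: $s_t$ is a function of $x_0,\dots,x_t$ and of $r_k,\gamma_k$,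 $k<t$. So is the decoder/controller: $u_t$ is a function of $r_k,\gamma_k$, $k\le t$. **Scheme.** Write $\hat x_t$ for the decoder's estimate of $x_0$ after slot $t$, with $\hat x_{-1}=0$ before the first slot, and $e_t=\hat x_t-x_0$. Let $\mathcal G_t=\sigma(\gamma_0,\dots,\gamma_t)$, with $\mathcal G_{-1}$ trivial. In each slot exactly one coordinate $j\in\{1,\dots,N\}$ uses the channel, and only its estimate is updated. - *Scheduler* with quotas $n_1,\dots,n_N\ge1$: coordinate $1$ uses the channel until its transmissions have succeeded ($\gamma_t=1$) $n_1$ times, then coordinate $2$ until its transmissions have succeeded $n_2$ times, and so on up to coordinate $N$; then this is repeated cyclically. - *First slot used by $j$*: $s_t=\sqrt{P/\mathrm{Var}(x_{j,0})}\;x_{j,0}$ and $\hat x_{j,t}=\sqrt{\mathrm{Var}(x_{j,0})/P}\;r_t$. - *Later slots used by $j$*: $$s_t=\sqrt{\frac{P}{\mathrm{Var}(e_{j,t-1}\mid\mathcal G_{t-1})}}\;e_{j,t-1},\qquad \hat x_{j,t}=\hat x_{j,t-1}-\frac{\mathbb E[r_te_{j,t-1}\mid\mathcal G_t]}{\mathbb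 E[r_t^2\mid\mathcal G_t]}\,r_t .$$ - *Controller*: $u_t=K\bigl(A^t\hat x_t+\sum_{i=1}^tA^{t-i}Bu_{i-1}\bigr)$, where $K$ is such that all eigenvalues of $A+BK$ lie in the open unit disk. **Theorem.** Suppose there are $\alpha_i>0$ with $\sum_{i=1}^d\alpha_i=1$ such that $$\ln|\lambda_i|<-\tfrac12\ln\bigl(\epsilon+(1-\epsilon)\,\delta^{\alpha_i/\mu_i}\bigr),\qquad i=1,\dots,d .$$ Then there are quotas $n_1,\dots,n_N\ge1$ such that, for every $K$ with $A+BK$ stable, the scheme above is a causal encoder/decoder pair that satisfies the power constraint $\mathbb E[s_t^2]\le P$ for all $t$ and stabilizes the system in mean square: $\lim_{t\to\infty}\mathbb E[x_tx_t']=0$. -/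

import Mathlib

open MeasureTheory ProbabilityTheory Filter Topology
open scoped NNReal ENNReal Matrix

noncomputable section

namespace LossyAWGN

/-! ### The plant -/

/-- Real dimension of the block attached to the eigenvalue `z` of algebraic multiplicity `m`. -/
def blockSize (z : ℂ) (m : ℕ) : ℕ := if z.im = 0 then m else 2 * m

/-- The real Jordan matrix with the single eigenvalue `z` (for non-real `z`: with the pair `z`,
`conj z`) of algebraic multiplicity `m`. The flags `c` say which neighbouring positions are
linked by a superdiagonal `1` (for non-real `z`: by a superdiagonal `2 × 2` identity); they thus
cut the matrix into elementary Jordan blocks. -/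
def realJordan (z : ℂ) (m : ℕ) (c : ℕ → Bool) :
    Matrix (Fin (blockSize z m)) (Fin (blockSize z m)) ℝ :=
  Matrix.of fun p q =>
    if z.im = 0 then
      if p.val = q.val then z.re
      else if p.val + 1 = q.val ∧ c p.val = true then 1 else 0
    else
      if p.val / 2 = q.val / 2 then
        if p.val % 2 = q.val % 2 then z.re
        else if p.val % 2 = 0 then z.im else -z.im
      else if p.val / 2 + 1 = q.val / 2 ∧ c (p.val / 2) = true ∧ p.val % 2 = q.val % 2 then 1
      else 0

/-- `A = diag(J₁, …, J_d)` is in real Jordan canonical form, `Jᵢ` having the eigenvalue `lam i`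
with algebraic multiplicity `m i`. -/
def IsRealJordanForm {N d : ℕ} (A : Matrix (Fin N) (Fin N) ℝ) (lam : Fin d → ℂ)
    (m : Fin d → ℕ) : Prop :=
  ∃ (c : Fin d → ℕ → Bool) (h : ∑ i, blockSize (lam i) (m i) = N),
    A = Matrix.reindex (finSigmaFinEquiv.trans (finCongr h)) (finSigmaFinEquiv.trans (finCongr h))
      (Matrix.blockDiagonal' fun i => realJordan (lam i) (m i) (c i))

/-- All complex eigenvalues of the real matrix `M` lie in the open unit disk. -/
def IsSchurStable {N : ℕ} (M : Matrix (Fin N) (Fin N) ℝ) : Prop :=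
  ∀ z ∈ spectrum ℂ (M.map (algebraMap ℝ ℂ)), ‖z‖ < 1

/-- The single-input pair `(A, B)` is stabilizable. -/
def IsStabilizable {N : ℕ} (A : Matrix (Fin N) (Fin N) ℝ) (B : Fin N → ℝ) : Prop :=
  ∃ K : Fin N → ℝ, IsSchurStable (A + Matrix.vecMulVec B K)

/-! ### The random sources and the channel -/

/-- The σ-algebras generated by `x₀`, by the `γ t` and by the `n t`, as one family. -/
@[reducible] def sourceSigma {Ω : Type*} {N : ℕ} (x₀ : Ω → Fin N → ℝ) (γ : ℕ → Ω → Bool) (n : ℕ → Ω → ℝ) :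
    Option (ℕ ⊕ ℕ) → MeasurableSpace Ω
  | none => MeasurableSpace.comap x₀ inferInstance
  | some (Sum.inl t) => MeasurableSpace.comap (γ t) inferInstance
  | some (Sum.inr t) => MeasurableSpace.comap (n t) inferInstance

/-- `x₀ ~ N(0, Σ₀)`; `γ t = true` (reception) with probability `1 - ε` and `γ t = false` (drop)
with probability `ε`; `n t ~ N(0, σ²)`; and `x₀, γ 0, n 0, γ 1, n 1, …` are independent. -/
structure IsSourceModel {Ω : Type*} [MeasurableSpace Ω] (P : Measure Ω) {N : ℕ}
    (S₀ : Matrix (Fin N) (Fin N) ℝ) (ε : ℝ) (v : ℝ≥0)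
    (x₀ : Ω → Fin N → ℝ) (γ : ℕ → Ω → Bool) (n : ℕ → Ω → ℝ) : Prop where
  measurable_init : Measurable x₀
  measurable_drop : ∀ t, Measurable (γ t)
  measurable_noise : ∀ t, Measurable (n t)
  law_init : P.map (fun ω => WithLp.toLp 2 (x₀ ω)) = multivariateGaussian 0 S₀
  law_received : ∀ t, P {ω | γ t ω = true} = ENNReal.ofReal (1 - ε)
  law_dropped : ∀ t, P {ω | γ t ω = false} = ENNReal.ofReal ε
  law_noise : ∀ t, P.map (n t) = gaussianReal 0 v
  indep : iIndep (sourceSigma x₀ γ n) P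

/-- What the channel outputs and drop indicators of the slots `0, …, t - 1` reveal. -/
@[reducible] def outputHistory {Ω : Type*} (γ : ℕ → Ω → Bool) (r : ℕ → Ω → ℝ) (t : ℕ) : MeasurableSpace Ω :=
  ⨆ k : Fin t, (MeasurableSpace.comap (r k) inferInstance ⊔
    MeasurableSpace.comap (γ k) inferInstance)

/-- What the states `x 0, …, x t` reveal. -/
@[reducible] def stateHistory {Ω : Type*} {N : ℕ} (x : ℕ → Ω → Fin N → ℝ) (t : ℕ) : MeasurableSpace Ω :=
  ⨆ k : Fin (t + 1), MeasurableSpace.comap (x k) inferInstance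

/-- The state `x`, channel input `s`, channel output `r` and control `u` obey the plant and
channel equations; the encoder (which sees the states up to time `t` and, through the feedback
link, the outputs and drop indicators before `t`) and the decoder/controller (which sees the
outputs and drop indicators up to `t`) are causal; the power constraint `E[s_t²] ≤ pow` holds;
and `E[x_t x_t'] → 0`. -/
structure MeanSquareStabilized {Ω : Type*} [MeasurableSpace Ω] (P : Measure Ω) {N : ℕ}
    (A : Matrix (Fin N) (Fin N) ℝ) (B : Fin N → ℝ) (pow : ℝ)
    (x₀ : Ω → Fin N → ℝ) (γ : ℕ → Ω → Bool) (n : ℕ → Ω → ℝ)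
    (x : ℕ → Ω → Fin N → ℝ) (s r u : ℕ → Ω → ℝ) : Prop where
  init : x 0 = x₀
  plant : ∀ t ω, x (t + 1) ω = A *ᵥ x t ω + u t ω • B
  channel : ∀ t ω, r t ω = (if γ t ω = true then 1 else 0) * s t ω + n t ω
  encoder_causal : ∀ t, Measurable[stateHistory x t ⊔ outputHistory γ r t] (s t)
  decoder_causal : ∀ t, Measurable[outputHistory γ r (t + 1)] (u t)
  memLp_input : ∀ t, MemLp (s t) 2 P
  power : ∀ t, ∫ ω, s t ω ^ 2 ∂P ≤ pow
  memLp_state : ∀ t i, MemLp (fun ω => x t ω i) 2 P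
  tendsto : ∀ i j, Tendsto (fun t => ∫ ω, x t ω i * x t ω j ∂P) atTop (𝓝 0)

/-! ### The adaptive TDMA scheduler -/

/-- Given quotas `q` and drop indicators `g`: the pair that uses the channel in slot `t`, and the
number of successes it has had so far in its current turn. A pair keeps the channel until its
transmissions have succeeded `q j` times; then the cyclically next pair takes over. -/
def schedState {N : ℕ} [NeZero N] (q : Fin N → ℕ) (g : ℕ → Bool) : ℕ → Fin N × ℕ
  | 0 => (0, 0)
  | t + 1 =>
    let a := schedState q g t
    if g t = true then
      if a.2 + 1 = q a.1 then (a.1 + 1, 0) else (a.1, a.2 + 1)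
    else a

/-- The pair scheduled in slot `t`. -/
def active {N : ℕ} [NeZero N] (q : Fin N → ℕ) (g : ℕ → Bool) (t : ℕ) : Fin N :=
  (schedState q g t).1

/-- Slot `t` is the first one used by the pair that is scheduled in it. -/
def IsFirstUse {N : ℕ} [NeZero N] (q : Fin N → ℕ) (g : ℕ → Bool) (t : ℕ) : Prop :=
  ∀ k < t, active q g k ≠ active q g t

/-! ### The encoder, the decoder and the controller -/

/-- What the drop indicators of the slots `0, …, t - 1` reveal. -/
@[reducible] def dropHistory {Ω : Type*} (γ : ℕ → Ω → Bool) (t : ℕ) : MeasurableSpace Ω :=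
  ⨆ k : Fin t, MeasurableSpace.comap (γ k) inferInstance

section Scheme

variable {Ω : Type*} [MeasurableSpace Ω] (P : Measure Ω) {N : ℕ} [NeZero N]
  (pow : ℝ) (q : Fin N → ℕ) (x₀ : Ω → Fin N → ℝ) (γ : ℕ → Ω → Bool) (n : ℕ → Ω → ℝ)

open Classical in
/-- The encoder in slot `t`, when `y` is the decoder's estimate of `x₀` before this slot. The
scheduled pair `j` sends `x₀ j` in its first slot and its current estimation error afterwards,
scaled to power `pow`; the variance of the error is taken given the past drop indicators, which
both ends know. -/
def encode (t : ℕ) (y : Ω → Fin N → ℝ) (ω : Ω) : ℝ :=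
  let j := active q (fun k => γ k ω) t
  if IsFirstUse q (fun k => γ k ω) t then
    √(pow / Var[fun ω' => x₀ ω' j; P]) * x₀ ω j
  else
    √(pow / (Var[fun ω' => y ω' j - x₀ ω' j; P | dropHistory γ t]) ω) * (y ω j - x₀ ω j)

/-- The lossy additive-noise channel in slot `t` with input `s`. -/
def transmit (t : ℕ) (s : Ω → ℝ) (ω : Ω) : ℝ :=
  (if γ t ω = true then 1 else 0) * s ω + n t ω

open Classical in
/-- The decoder in slot `t`: the estimate `y` is updated, in the scheduled coordinate only, with
the channel output `r`; after the first use of a pair by the linear minimum-mean-square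
correction given the drop indicators. -/
def decode (t : ℕ) (y : Ω → Fin N → ℝ) (r : Ω → ℝ) (ω : Ω) (j : Fin N) : ℝ :=
  if j = active q (fun k => γ k ω) t then
    if IsFirstUse q (fun k => γ k ω) t then
      √(Var[fun ω' => x₀ ω' j; P] / pow) * r ω
    else
      y ω j - (P[fun ω' => r ω' * (y ω' j - x₀ ω' j) | dropHistory γ (t + 1)]) ω /
        (P[fun ω' => r ω' ^ 2 | dropHistory γ (t + 1)]) ω * r ω
  else y ω j

/-- The decoder's estimate of `x₀` before slot `t`, so that `estimate (t + 1)` is the estimate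
`x̂_t` that is available once slot `t` is over. -/
def estimate : ℕ → Ω → Fin N → ℝ
  | 0 => fun _ _ => 0
  | t + 1 =>
    decode P pow q x₀ γ t (estimate t) (transmit γ n t (encode P pow q x₀ γ t (estimate t)))

/-- The channel input. -/
def channelInput (t : ℕ) : Ω → ℝ := encode P pow q x₀ γ t (estimate P pow q x₀ γ n t)

/-- The channel output. -/
def channelOutput (t : ℕ) : Ω → ℝ := transmit γ n t (channelInput P pow q x₀ γ n t)

variable (A : Matrix (Fin N) (Fin N) ℝ) (B K : Fin N → ℝ)

/-- The control `u_t = K (A^t x̂_t + ∑_{k < t} A^(t-1-k) B u_k)`. -/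
def control (t : ℕ) (ω : Ω) : ℝ :=
  K ⬝ᵥ (A ^ t *ᵥ estimate P pow q x₀ γ n (t + 1) ω +
    ∑ k : Fin t, control k.val ω • (A ^ (t - 1 - k.val) *ᵥ B))
termination_by t
decreasing_by exact k.isLt

/-- The closed-loop state. -/
def state : ℕ → Ω → Fin N → ℝ
  | 0 => x₀
  | t + 1 => fun ω => A *ᵥ state t ω + control P pow q x₀ γ n A B K t ω • B

end Scheme

end LossyAWGN

end

noncomputable section
namespace LossyAWGN

/-! ### Growth of matrix powers -/

/-! The estimator of `x₀` is not affected by the control, so the problem splits. The controller adds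
the known effect of the past inputs to `A ^ t x̂_t`, hence applies `K` to `x_t + A ^ t e_t` with
`e_t = x̂_t - x₀`, and the closed loop is `x_{t+1} = (A + B K) x_t + (K A ^ t e_t) B`
(`state_succ`). A stable recursion whose input has a geometrically decaying second moment tends to
zero in mean square (`tendsto_integral_mul_of_stable`). It remains to bound `K A ^ t e_t`.

Along a fixed path of drop indicators the estimator is linear in `x₀` and the noise, with
deterministic coefficients; `frozenErr` and `errVar` are its error and the variance of the error.
The indicators are independent of `x₀` and the noise, so conditional moments given the indicators
are frozen moments evaluated at the actual path (`condExp_frozen`), and by induction the scheme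
almost surely follows the frozen error (`estimate_ae`).

With `δ = v / (v + pow)`, the variance for coordinate `j` is at most a constant times `δ` to the
number of its successes (`errVar_le`). Up to a bounded defect this number is the share `β_j = q_j /
∑ q_i` of all receptions (`quota_mul_sum_le`). Receptions are binomial, so the mean square error is
`O((ε + (1 - ε) δ ^ β_j) ^ t)` (`IsSourceModel.exists_integral_estimate_sub_sq_le`).

Conversely, `A ^ t` amplifies block `i` at most like `ρ_i ^ t` for any `ρ_i > |λ_i|`
(`IsRealJordanForm.exists_pow_mulVec_le`). The hypothesis says `|λ_i|² (ε + (1 - ε) δ ^ (α_i / μ_i))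
< 1`. Being strict, it survives replacing `|λ_i|` by a slightly larger `ρ_i`, and replacing the
weights `α_i / μ_i`, which sum to one over all coordinates, by nearby shares of integer quotas. -/

/-- The entries of a vector, continued by zero. -/
def extendZero {n : ℕ} (y : Fin n → ℝ) (k : ℕ) : ℝ := if h : k < n then y ⟨k, h⟩ else 0

lemma extendZero_val {n : ℕ} (y : Fin n → ℝ) (p : Fin n) : extendZero y p.val = y p := by
  simp [extendZero]

lemma extendZero_of_le {n : ℕ} (y : Fin n → ℝ) {k : ℕ} (h : n ≤ k) : extendZero y k = 0 := by
  simp [extendZero, h]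

lemma sum_ite_val_eq {n : ℕ} (y : Fin n → ℝ) (k : ℕ) :
    ∑ q : Fin n, (if q.val = k then y q else 0) = extendZero y k := by
  by_cases h : k < n
  · have : ∀ q : Fin n, (q.val = k) ↔ q = ⟨k, h⟩ := fun q => by rw [Fin.ext_iff]
    simp [this, extendZero, h]
  · rw [extendZero, dif_neg h]
    refine Finset.sum_eq_zero fun q _ => if_neg ?_
    have := q.isLt
    omega

lemma abs_extendZero_le_sum {n : ℕ} (y : Fin n → ℝ) (k : ℕ) :
    |extendZero y k| ≤ ∑ q, |y q| := by
  by_cases h : k < n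
  · rw [extendZero, dif_pos h]
    exact Finset.single_le_sum (f := fun q => |y q|) (fun _ _ => abs_nonneg _)
      (Finset.mem_univ (⟨k, h⟩ : Fin n))
  · rw [extendZero, dif_neg h, abs_zero]
    exact Finset.sum_nonneg fun _ _ => abs_nonneg _

/-- If a family of gauges `W y k` obeys `W (J y) k ≤ r W y k + W y (k + 1)` and vanishes for large
`k`, then it grows under the powers of `J` at most like every `ρ ^ t` with `ρ > r`. -/
lemma pow_mulVec_gauge_le {n : ℕ} (J : Matrix (Fin n) (Fin n) ℝ) (W : (Fin n → ℝ) → ℕ → ℝ)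
    (r ρ : ℝ) (hr : 0 ≤ r) (hρ : r < ρ) (L : ℕ) (hW0 : ∀ y k, L ≤ k → W y k = 0)
    (hstep : ∀ y k, W (J *ᵥ y) k ≤ r * W y k + W y (k + 1))
    (hbd : ∀ y k, W y k ≤ 2 * ∑ q, |y q|) :
    ∃ C : ℝ, 0 ≤ C ∧ ∀ (t : ℕ) y k, W (J ^ t *ᵥ y) k ≤ C * ρ ^ t * ∑ q, |y q| := by
  -- Weighting the `k`-th gauge by `η ^ k` shrinks the superdiagonal coupling to `η`, so that one
  -- step costs at most `r + η ≤ ρ`.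
  obtain ⟨η, hη0, hη1, hηρ⟩ : ∃ η : ℝ, 0 < η ∧ η ≤ 1 ∧ r + η ≤ ρ :=
    ⟨min 1 (ρ - r), by simp [hρ], min_le_left _ _, by linarith [min_le_right 1 (ρ - r)]⟩
  have hρ0 : 0 < ρ := by linarith
  refine ⟨2 / η ^ L, by positivity, fun t y k => ?_⟩
  have hS : 0 ≤ ∑ q, |y q| := Finset.sum_nonneg fun _ _ => abs_nonneg _
  -- The factor `1 / η ^ L` pays for the weight at `t = 0`, since `η ^ L ≤ η ^ k` whenever the gauge
  -- is not already zero.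
  have key : ∀ (t : ℕ) k, W (J ^ t *ᵥ y) k ≤ 2 / η ^ L * η ^ k * ρ ^ t * ∑ q, |y q| := by
    intro t
    induction t with
    | zero =>
      intro k
      rcases le_or_gt L k with h | h
      · rw [hW0 _ _ h]; positivity
      · refine (hbd _ k).trans ?_
        simp only [pow_zero, Matrix.one_mulVec, mul_one]
        refine mul_le_mul_of_nonneg_right ?_ hS
        rw [div_mul_eq_mul_div, le_div_iff₀ (by positivity)]
        exact mul_le_mul_of_nonneg_left (pow_le_pow_of_le_one hη0.le hη1 h.le) (by norm_num)
    | succ t ih =>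
      intro k
      rw [pow_succ', ← Matrix.mulVec_mulVec]
      refine (hstep _ k).trans ?_
      have h1 := ih k
      have h2 := ih (k + 1)
      set D := 2 / η ^ L * η ^ k * ρ ^ t * ∑ q, |y q| with hD
      have hD0 : 0 ≤ D := by positivity
      have h3 : 2 / η ^ L * η ^ (k + 1) * ρ ^ t * ∑ q, |y q| = η * D := by rw [hD]; ring
      have h4 : 2 / η ^ L * η ^ k * ρ ^ (t + 1) * ∑ q, |y q| = ρ * D := by rw [hD]; ring
      rw [h3] at h2
      rw [h4]
      nlinarith [mul_le_mul_of_nonneg_left h1 hr, mul_le_mul_of_nonneg_right hηρ hD0]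
  refine (key t k).trans ?_
  have : η ^ k ≤ 1 := pow_le_one₀ hη0.le hη1
  calc 2 / η ^ L * η ^ k * ρ ^ t * ∑ q, |y q| = η ^ k * (2 / η ^ L * ρ ^ t * ∑ q, |y q|) := by ring
    _ ≤ 1 * (2 / η ^ L * ρ ^ t * ∑ q, |y q|) := by gcongr
    _ = _ := one_mul _

lemma realJordan_mulVec_of_real {z : ℂ} (hz : z.im = 0) (m : ℕ) (c : ℕ → Bool)
    (y : Fin (blockSize z m) → ℝ) (p : Fin (blockSize z m)) :
    (realJordan z m c *ᵥ y) p =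
      z.re * extendZero y p + (if c p = true then 1 else 0) * extendZero y (p + 1) := by
  rw [← sum_ite_val_eq, ← sum_ite_val_eq, Finset.mul_sum, Finset.mul_sum,
    ← Finset.sum_add_distrib, Matrix.mulVec, dotProduct]
  refine Finset.sum_congr rfl fun q _ => ?_
  simp only [realJordan, Matrix.of_apply, if_pos hz]
  by_cases h1 : q.val = p.val
  · simp [h1]
  · have h1' : p.val ≠ q.val := fun h => h1 h.symm
    by_cases h2 : q.val = p.val + 1
    · simp [h2]
    · have h2' : p.val + 1 ≠ q.val := fun h => h2 h.symm
      simp [h1, h2, h1', h2']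

lemma realJordan_mulVec_even {z : ℂ} (hz : z.im ≠ 0) (m : ℕ) (c : ℕ → Bool)
    (y : Fin (blockSize z m) → ℝ) (k : ℕ) (hk : 2 * k < blockSize z m) :
    (realJordan z m c *ᵥ y) ⟨2 * k, hk⟩ =
      z.re * extendZero y (2 * k) + z.im * extendZero y (2 * k + 1) +
        (if c k = true then 1 else 0) * extendZero y (2 * k + 2) := by
  simp only [← sum_ite_val_eq, Finset.mul_sum, ← Finset.sum_add_distrib, Matrix.mulVec, dotProduct]
  refine Finset.sum_congr rfl fun q _ => ?_
  simp only [realJordan, Matrix.of_apply, if_neg hz]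
  obtain ⟨q, hq⟩ := q
  have e1 : 2 * k / 2 = k := by omega
  have e2 : 2 * k % 2 = 0 := by omega
  simp only [e1, e2]
  by_cases h0 : q = 2 * k
  · subst h0; simp
  by_cases h1 : q = 2 * k + 1
  · subst h1
    have f1 : (2 * k + 1) / 2 = k := by omega
    have f2 : (2 * k + 1) % 2 = 1 := by omega
    simp [f1, f2]
  by_cases h2 : q = 2 * k + 2
  · subst h2
    have f1 : (2 * k + 2) / 2 = k + 1 := by omega
    simp [f1]
  have g1 : k ≠ q / 2 := by omega
  have g2 : ¬ (k + 1 = q / 2 ∧ c k = true ∧ 0 = q % 2) := by omega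
  simp [h0, h1, h2, g1, g2]

lemma realJordan_mulVec_odd {z : ℂ} (hz : z.im ≠ 0) (m : ℕ) (c : ℕ → Bool)
    (y : Fin (blockSize z m) → ℝ) (k : ℕ) (hk : 2 * k + 1 < blockSize z m) :
    (realJordan z m c *ᵥ y) ⟨2 * k + 1, hk⟩ =
      -z.im * extendZero y (2 * k) + z.re * extendZero y (2 * k + 1) +
        (if c k = true then 1 else 0) * extendZero y (2 * k + 3) := by
  simp only [← sum_ite_val_eq, Finset.mul_sum, ← Finset.sum_add_distrib, Matrix.mulVec, dotProduct]
  refine Finset.sum_congr rfl fun q _ => ?_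
  simp only [realJordan, Matrix.of_apply, if_neg hz]
  obtain ⟨q, hq⟩ := q
  have e1 : (2 * k + 1) / 2 = k := by omega
  have e2 : (2 * k + 1) % 2 = 1 := by omega
  simp only [e1, e2]
  by_cases h0 : q = 2 * k
  · subst h0
    have f1 : (2 * k) / 2 = k := by omega
    have f2 : (2 * k) % 2 = 0 := by omega
    simp [f1, f2]
  by_cases h1 : q = 2 * k + 1
  · subst h1
    simp [e1, e2]
  by_cases h2 : q = 2 * k + 3
  · subst h2
    have f1 : (2 * k + 3) / 2 = k + 1 := by omega
    have f2 : (2 * k + 3) % 2 = 1 := by omega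
    simp [f1, f2]
  have g1 : k ≠ q / 2 := by omega
  have g2 : ¬ (k + 1 = q / 2 ∧ c k = true ∧ 1 = q % 2) := by omega
  simp [h0, h1, h2, g1, g2]

/-- The powers of a real Jordan matrix grow at most like `ρ ^ t` for every `ρ` above the modulus
of its eigenvalue. -/
lemma exists_realJordan_pow_mulVec_le (z : ℂ) (m : ℕ) (c : ℕ → Bool) {ρ : ℝ} (hρ : ‖z‖ < ρ) :
    ∃ C : ℝ, 0 ≤ C ∧ ∀ (t : ℕ) (y : Fin (blockSize z m) → ℝ) p,
      |(realJordan z m c ^ t *ᵥ y) p| ≤ C * ρ ^ t * ∑ q, |y q| := by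
  by_cases hz : z.im = 0
  · obtain ⟨C, hC, h⟩ := pow_mulVec_gauge_le (realJordan z m c) (fun y k => |extendZero y k|) ‖z‖ ρ
      (norm_nonneg _) hρ (blockSize z m) (fun y k hk => by simp [extendZero_of_le y hk])
      (fun y k => by
        by_cases hk : k < blockSize z m
        · have e := realJordan_mulVec_of_real hz m c y ⟨k, hk⟩
          rw [← extendZero_val (realJordan z m c *ᵥ y)] at e
          simp only at e
          rw [e]
          refine (abs_add_le _ _).trans (add_le_add ?_ ?_)
          · rw [abs_mul]
            exact mul_le_mul_of_nonneg_right (Complex.abs_re_le_norm z) (abs_nonneg _)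
          · split_ifs <;> simp
        · rw [extendZero_of_le _ (not_lt.1 hk), abs_zero]
          positivity)
      (fun y k => by
        have h1 := abs_extendZero_le_sum y k
        have h2 : 0 ≤ ∑ q, |y q| := Finset.sum_nonneg fun _ _ => abs_nonneg _
        linarith)
    exact ⟨C, hC, fun t y p => by simpa [extendZero_val] using h t y p⟩
  · have hsz : blockSize z m = 2 * m := by simp [blockSize, hz]
    -- Reading each pair of real coordinates as a complex number turns the `2 × 2` rotation block
    -- into multiplication by `conj z`, whose modulus is exactly `‖z‖`.
    let w : (Fin (blockSize z m) → ℝ) → ℕ → ℂ := fun y k =>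
      ⟨extendZero y (2 * k), extendZero y (2 * k + 1)⟩
    obtain ⟨C, hC, h⟩ := pow_mulVec_gauge_le (realJordan z m c) (fun y k => ‖w y k‖) ‖z‖ ρ
      (norm_nonneg _) hρ m
      (fun y k hk => by
        have : w y k = 0 := Complex.ext (extendZero_of_le _ (by omega))
          (extendZero_of_le _ (by omega))
        simp [this])
      (fun y k => by
        by_cases hk : k < m
        · have e0 := realJordan_mulVec_even hz m c y k (by omega)
          have e1 := realJordan_mulVec_odd hz m c y k (by omega)
          rw [← extendZero_val (realJordan z m c *ᵥ y)] at e0 e1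
          simp only at e0 e1
          have : w (realJordan z m c *ᵥ y) k =
              (starRingEnd ℂ) z * w y k + (if c k = true then 1 else 0) * w y (k + 1) := by
            apply Complex.ext
            · simp only [w, e0]
              split_ifs <;> simp ; ring_nf
            · simp only [w, e1]
              split_ifs <;> simp <;> ring_nf
          simp only [this]
          refine (norm_add_le _ _).trans (add_le_add ?_ ?_)
          · simp
          · split_ifs <;> simp
        · have : w (realJordan z m c *ᵥ y) k = 0 := Complex.ext (extendZero_of_le _ (by omega))
            (extendZero_of_le _ (by omega))
          simp only [this, norm_zero]
          positivity)
      (fun y k => by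
        have h1 := abs_extendZero_le_sum y (2 * k)
        have h2 := abs_extendZero_le_sum y (2 * k + 1)
        have := Complex.norm_le_abs_re_add_abs_im (w y k)
        simp only [w] at this
        linarith)
    refine ⟨C, hC, fun t y p => ?_⟩
    refine le_trans ?_ (h t y (p.val / 2))
    rw [← extendZero_val (realJordan z m c ^ t *ᵥ y)]
    rcases Nat.mod_two_eq_zero_or_one p.val with hp | hp
    · have : p.val = 2 * (p.val / 2) := by omega
      refine le_trans (le_of_eq ?_) (Complex.abs_re_le_norm _)
      simp only [w]
      rw [← this]
    · have : p.val = 2 * (p.val / 2) + 1 := by omega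
      refine le_trans (le_of_eq ?_) (Complex.abs_im_le_norm _)
      simp only [w]
      rw [← this]

lemma blockDiagonal'_mulVec_apply {o : Type*} [Fintype o] [DecidableEq o] {n : o → Type*}
    [∀ i, Fintype (n i)] (M : ∀ i, Matrix (n i) (n i) ℝ) (y : (Σ i, n i) → ℝ) (i : o) (p : n i) :
    (Matrix.blockDiagonal' M *ᵥ y) ⟨i, p⟩ = (M i *ᵥ fun k => y ⟨i, k⟩) p := by
  simp only [Matrix.mulVec, dotProduct, Fintype.sum_sigma]
  rw [Finset.sum_eq_single i]
  · simp
  · intro b _ hb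
    exact Finset.sum_eq_zero fun k _ => by
      rw [Matrix.blockDiagonal'_apply_ne _ _ _ hb.symm, zero_mul]
  · simp

/-- The powers of a matrix in real Jordan form, block by block: `e` enumerates the coordinates. -/
lemma IsRealJordanForm.exists_pow_mulVec_le {N d : ℕ} {A : Matrix (Fin N) (Fin N) ℝ}
    {lam : Fin d → ℂ} {m : Fin d → ℕ} (hA : IsRealJordanForm A lam m) :
    ∃ e : (Σ i, Fin (blockSize (lam i) (m i))) ≃ Fin N,
      ∀ ρ : Fin d → ℝ, (∀ i, ‖lam i‖ < ρ i) → ∃ C : ℝ, 0 ≤ C ∧ ∀ (t : ℕ) (y : Fin N → ℝ) i p,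
        |(A ^ t *ᵥ y) (e ⟨i, p⟩)| ≤ C * ρ i ^ t * ∑ k, |y (e ⟨i, k⟩)| := by
  obtain ⟨c, h, rfl⟩ := hA
  refine ⟨finSigmaFinEquiv.trans (finCongr h), fun ρ hρ => ?_⟩
  set e := finSigmaFinEquiv.trans (finCongr h)
  choose C hC0 hC using fun i => exists_realJordan_pow_mulVec_le (lam i) (m i) (c i) (hρ i)
  refine ⟨∑ i, C i, Finset.sum_nonneg fun i _ => hC0 i, fun t y i p => ?_⟩
  have hpow : Matrix.reindex e e (Matrix.blockDiagonal' fun i => realJordan (lam i) (m i) (c i)) ^ t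
      = Matrix.reindex e e (Matrix.blockDiagonal' fun i => realJordan (lam i) (m i) (c i) ^ t) := by
    have h1 := (map_pow (Matrix.reindexAlgEquiv ℝ ℝ e)
      (Matrix.blockDiagonal' fun i => realJordan (lam i) (m i) (c i)) t).symm
    rw [← Matrix.blockDiagonal'_pow] at h1
    exact h1
  have hval : (Matrix.reindex e e
      (Matrix.blockDiagonal' fun i => realJordan (lam i) (m i) (c i)) ^ t *ᵥ y) (e ⟨i, p⟩) =
      (realJordan (lam i) (m i) (c i) ^ t *ᵥ fun k => y (e ⟨i, k⟩)) p := by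
    rw [hpow, ← blockDiagonal'_mulVec_apply (fun i => realJordan (lam i) (m i) (c i) ^ t)
      (fun k => y (e k)) i p]
    simp only [Matrix.mulVec, dotProduct, Matrix.reindex_apply, Matrix.submatrix_apply]
    rw [← Equiv.sum_comp e]
    simp
  rw [hval]
  refine (hC i t _ p).trans ?_
  have h2 : C i ≤ ∑ i, C i := Finset.single_le_sum (fun i _ => hC0 i) (Finset.mem_univ i)
  have h3 : 0 ≤ ρ i := (norm_nonneg _).trans (hρ i).le
  gcongr

/-! ### Powers of a Schur stable matrix -/

section
attribute [local instance] Matrix.linftyOpNormedRing Matrix.linftyOpNormedAlgebra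

/-- The powers of a Schur stable matrix decay geometrically. -/
lemma IsSchurStable.exists_pow_mulVec_le {N : ℕ} {F : Matrix (Fin N) (Fin N) ℝ}
    (hF : IsSchurStable F) : ∃ C ρ : ℝ, 0 ≤ C ∧ 0 < ρ ∧ ρ < 1 ∧ ∀ (t : ℕ) (y : Fin N → ℝ) p,
      |(F ^ t *ᵥ y) p| ≤ C * ρ ^ t * ∑ q, |y q| := by
  rcases isEmpty_or_nonempty (Fin N) with hN | hN
  · exact ⟨0, 1 / 2, le_rfl, by norm_num, by norm_num, fun t y p => isEmptyElim p⟩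
  set M := F.map (algebraMap ℝ ℂ) with hM
  have hcs : CompleteSpace (Matrix (Fin N) (Fin N) ℂ) := FiniteDimensional.complete ℂ _
  have hr : spectralRadius ℂ M < 1 := by
    have := spectrum.spectralRadius_lt_of_forall_lt M (r := 1) fun z hz => by
      have := hF z hz
      exact_mod_cast this
    simpa using this
  obtain ⟨ρ, hρ1, hρ2⟩ := ENNReal.lt_iff_exists_nnreal_btwn.1 hr
  have hρ0 : (0 : ℝ) < ρ := by
    have : (0 : ℝ≥0∞) < ρ := (zero_le).trans_lt hρ1
    exact_mod_cast this
  -- Gelfand's formula gives the bound for large `t`; the finitely many remaining powers are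
  -- absorbed into the constant `C`.
  have hev : ∀ᶠ t : ℕ in atTop, ‖M ^ t‖ / (ρ : ℝ) ^ t ≤ 1 := by
    have h1 := (spectrum.pow_nnnorm_pow_one_div_tendsto_nhds_spectralRadius M).eventually
      (gt_mem_nhds hρ1)
    filter_upwards [h1, eventually_gt_atTop 0] with t ht ht0
    rw [div_le_one (by positivity)]
    have h2 : (‖M ^ t‖₊ : ℝ≥0∞) ≤ (ρ : ℝ≥0∞) ^ t := by
      have := ENNReal.rpow_le_rpow ht.le (Nat.cast_nonneg t : (0 : ℝ) ≤ t)
      rwa [← ENNReal.rpow_mul, one_div_mul_cancel (by positivity), ENNReal.rpow_one,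
        ENNReal.rpow_natCast] at this
    exact_mod_cast h2
  obtain ⟨C, hC⟩ := (isBoundedUnder_of_eventually_le hev).bddAbove_range
  have hC' : ∀ t : ℕ, ‖M ^ t‖ ≤ C * (ρ : ℝ) ^ t := fun t => by
    have := hC ⟨t, rfl⟩
    simp only at this
    rwa [div_le_iff₀ (by positivity)] at this
  have hC0 : 0 ≤ C := by simpa using (norm_nonneg _).trans (hC' 0)
  refine ⟨C, ρ, hC0, hρ0, by exact_mod_cast hρ2, fun t y p => ?_⟩
  have hent : ∀ q, |(F ^ t) p q| ≤ C * (ρ : ℝ) ^ t := fun q => by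
    refine le_trans ?_ (hC' t)
    have e : M ^ t = (F ^ t).map (algebraMap ℝ ℂ) := by
      rw [hM]
      exact (map_pow (RingHom.mapMatrix (algebraMap ℝ ℂ)) F t).symm
    have h1 : |(F ^ t) p q| = ‖(M ^ t) p q‖ := by rw [e]; simp
    rw [h1, Matrix.linfty_opNorm_def]
    have h2 : ‖(M ^ t) p q‖₊ ≤ ∑ j, ‖(M ^ t) p j‖₊ :=
      Finset.single_le_sum (f := fun j => ‖(M ^ t) p j‖₊) (fun _ _ => zero_le)
        (Finset.mem_univ q)
    have h3 := h2.trans (Finset.le_sup (f := fun i => ∑ j, ‖(M ^ t) i j‖₊) (Finset.mem_univ p))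
    exact_mod_cast h3
  rw [Matrix.mulVec, dotProduct, Finset.mul_sum]
  refine (Finset.abs_sum_le_sum_abs _ _).trans (Finset.sum_le_sum fun q _ => ?_)
  rw [abs_mul]
  exact mul_le_mul_of_nonneg_right (hent q) (abs_nonneg _)

end

/-! ### The scheduler -/

section Scheduler

variable {N : ℕ} [NeZero N] (q : Fin N → ℕ)

/-- Causality of the scheduler. This and the later `_congr` lemmas reduce every path-dependent
quantity to finitely many prefixes, which is what makes conditioning elementary. -/
lemma schedState_congr {g g' : ℕ → Bool} {t : ℕ} (h : ∀ k < t, g k = g' k) :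
    schedState q g t = schedState q g' t := by
  induction t with
  | zero => rfl
  | succ t ih =>
    simp only [schedState, ih fun k hk => h k (hk.trans t.lt_succ_self), h t t.lt_succ_self]

lemma active_congr {g g' : ℕ → Bool} {t : ℕ} (h : ∀ k < t, g k = g' k) :
    active q g t = active q g' t := by
  rw [active, active, schedState_congr q h]

lemma isFirstUse_congr {g g' : ℕ → Bool} {t : ℕ} (h : ∀ k < t, g k = g' k) :
    IsFirstUse q g t ↔ IsFirstUse q g' t := by
  refine forall₂_congr fun k hk => ?_
  rw [active_congr q h, active_congr q fun i hi => h i (hi.trans hk)]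

/-- The number of successes that the pair `j` has had before slot `t`. -/
def successCount (g : ℕ → Bool) (j : Fin N) (t : ℕ) : ℕ :=
  ∑ k ∈ Finset.range t, if g k = true ∧ active q g k = j then 1 else 0

lemma sum_successCount (g : ℕ → Bool) (t : ℕ) :
    ∑ j, successCount q g j t = ∑ k ∈ Finset.range t, if g k = true then 1 else 0 := by
  unfold successCount
  rw [Finset.sum_comm]
  refine Finset.sum_congr rfl fun k _ => ?_
  by_cases h : g k = true <;> simp [h]

lemma successCount_succ (g : ℕ → Bool) (j : Fin N) (t : ℕ) :
    successCount q g j (t + 1) =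
      successCount q g j t + if g t = true ∧ active q g t = j then 1 else 0 :=
  Finset.sum_range_succ _ _

lemma successCount_eq_zero {g : ℕ → Bool} {t : ℕ} {j : Fin N} (h : ∀ k < t, active q g k ≠ j) :
    successCount q g j t = 0 :=
  Finset.sum_eq_zero fun k hk => if_neg fun hk' => h k (Finset.mem_range.1 hk) hk'.2

/-- After `R` complete rounds every pair has had `R` times its quota of successes. -/
lemma exists_successCount_eq (hq : ∀ j, 1 ≤ q j) (g : ℕ → Bool) (t : ℕ) :
    (schedState q g t).2 < q (schedState q g t).1 ∧ ∃ R, ∀ j, successCount q g j t = R * q j +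
      if j < (schedState q g t).1 then q j
      else if j = (schedState q g t).1 then (schedState q g t).2 else 0 := by
  induction t with
  | zero =>
    refine ⟨hq _, 0, fun j => ?_⟩
    have : ¬ j < 0 := not_lt.2 (Fin.zero_le _)
    simp only [successCount, schedState, this, Finset.range_zero, Finset.sum_empty, if_false]
    rw [zero_mul, zero_add]
    exact (ite_self 0).symm
  | succ t ih =>
    obtain ⟨hlt, R, hR⟩ := ih
    have hact : active q g t = (schedState q g t).1 := rfl
    simp only [successCount_succ, hR, hact]
    by_cases hg : g t = true
    · simp only [schedState, hg, if_true, true_and]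
      set a := (schedState q g t).1
      set c := (schedState q g t).2
      by_cases hc : c + 1 = q a
      · simp only [hc, if_true]
        have hval : (a + 1).val = (a.val + 1) % N := by
          rw [Fin.val_add, Fin.val_one', Nat.add_mod_mod]
        refine ⟨hq _, ?_⟩
        -- If the last coordinate fills its quota, addition in `Fin N` wraps to `0` and a new round
        -- begins; otherwise the round number stays.
        by_cases hl : a.val + 1 = N
        · have h0 : (a + 1).val = 0 := by rw [hval, hl, Nat.mod_self]
          refine ⟨R + 1, fun j => ?_⟩
          have hj : ¬ j < a + 1 := by rw [Fin.lt_def, h0]; omega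
          have hja : j.val ≤ a.val := by have := j.isLt; omega
          rw [if_neg hj]
          rcases hja.lt_or_eq with h | h
          · have h1 : j < a := h
            have h2 : ¬ a = j := fun e => h1.ne e.symm
            simp [h1, h2]; ring
          · have h1 : j = a := Fin.ext h
            subst h1
            simp
            linarith
        · have h0 : (a + 1).val = a.val + 1 := by
            rw [hval, Nat.mod_eq_of_lt (by have := a.isLt; omega)]
          refine ⟨R, fun j => ?_⟩
          rcases lt_trichotomy j a with h | h | h
          · have h1 : j < a + 1 := by rw [Fin.lt_def] at h ⊢; omega
            have h2 : ¬ a = j := h.ne'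
            simp [h, h1, h2]
          · subst h
            have h1 : a < a + 1 := by rw [Fin.lt_def]; omega
            simp only [h1, if_true, lt_irrefl, if_false]
            omega
          · have h1 : ¬ j < a + 1 := by rw [Fin.lt_def] at h ⊢; omega
            have h2 : ¬ a = j := h.ne
            have h3 : ¬ j < a := h.not_gt
            have h4 : ¬ j = a := h.ne'
            simp [h1, h2, h3, h4]
      · simp only [hc, if_false]
        refine ⟨by omega, R, fun j => ?_⟩
        rcases lt_trichotomy j a with h | h | h
        · simp [h, h.ne']
        · subst h; simp; ring
        · simp [h.not_gt, h.ne', h.ne]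
    · simp only [schedState, hg]
      exact ⟨hlt, R, fun j => rfl⟩

/-- Up to one round, the successes are shared in the proportion of the quotas. -/
lemma quota_mul_sum_le (hq : ∀ j, 1 ≤ q j) (g : ℕ → Bool) (j : Fin N) (t : ℕ) :
    q j * (∑ k ∈ Finset.range t, if g k = true then 1 else 0) ≤
      (∑ i, q i) * successCount q g j t + q j * ∑ i, q i := by
  obtain ⟨hlt, R, hR⟩ := exists_successCount_eq q hq g t
  rw [← sum_successCount q]
  -- All coordinates together are inside round `R + 1`, while `j` alone has completed `R` quotas;
  -- the defect is at most one round.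
  have h1 : ∑ i, successCount q g i t ≤ (R + 1) * ∑ i, q i := by
    rw [Finset.mul_sum]
    refine Finset.sum_le_sum fun i _ => ?_
    rw [hR, add_mul, one_mul]
    gcongr
    split_ifs with h1 h2
    · exact le_rfl
    · rw [h2]; exact hlt.le
    · exact Nat.zero_le _
  have h2 : R * q j ≤ successCount q g j t := by rw [hR]; exact Nat.le_add_right _ _
  nlinarith [Nat.mul_le_mul_left (q j) h1, Nat.mul_le_mul_left (∑ i, q i) h2]

end Scheduler

/-! ### The estimation error along a fixed path of drop indicators -/

section Frozen

variable {N : ℕ} [NeZero N] (q : Fin N → ℕ) (pow v : ℝ) (s2 : Fin N → ℝ)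

open Classical in
/-- The factor by which slot `t` scales the error of coordinate `j`. -/
def errGain (g : ℕ → Bool) (t : ℕ) (j : Fin N) : ℝ :=
  -- A successful first use cancels `x₀` completely, hence `0`. After a dropped first use the
  -- estimate is pure noise, so the error still contains `-x₀` with gain `1`.
  if j = active q g t ∧ g t = true then (if IsFirstUse q g t then 0 else v / (v + pow)) else 1

open Classical in
/-- The factor with which the noise of slot `t` enters the error of coordinate `j`, when the error
has variance `V` before the slot. -/
def noiseGain (g : ℕ → Bool) (t : ℕ) (j : Fin N) (V : ℝ) : ℝ :=
  if j = active q g t then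
    -- In the first slot the estimate is overwritten by the rescaled output, so noise enters even if
    -- the packet is dropped. Later the gain is the linear regression coefficient `E[r e] / E[r²]`,
    -- which vanishes on a drop.
    if IsFirstUse q g t then √(s2 j / pow)
    else if g t = true then -(√(pow / V) * V / (pow + v)) else 0
  else 0

/-- The variance of the error of coordinate `j` before slot `t`. -/
def errVar (g : ℕ → Bool) : ℕ → Fin N → ℝ
  | 0, j => s2 j
  | t + 1, j => errGain q pow v g t j ^ 2 * errVar g t j +
      noiseGain q pow v s2 g t j (errVar g t j) ^ 2 * v

/-- The error of coordinate `j` before slot `t`, for the path `g` of drop indicators. -/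
def frozenErr {Ω : Type*} (x₀ : Ω → Fin N → ℝ) (n : ℕ → Ω → ℝ) (g : ℕ → Bool) :
    ℕ → Fin N → Ω → ℝ
  | 0, j => fun ω => -x₀ ω j
  | t + 1, j => fun ω => errGain q pow v g t j * frozenErr x₀ n g t j ω +
      noiseGain q pow v s2 g t j (errVar q pow v s2 g t j) * n t ω

lemma errGain_congr {g g' : ℕ → Bool} {t : ℕ} (h : ∀ k < t + 1, g k = g' k) (j : Fin N) :
    errGain q pow v g t j = errGain q pow v g' t j := by
  have h' : ∀ k < t, g k = g' k := fun k hk => h k (by omega)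
  have hf := isFirstUse_congr q h'
  simp only [errGain, active_congr q h', h t t.lt_succ_self]
  by_cases h1 : IsFirstUse q g t
  · simp only [h1, hf.1 h1]
  · simp only [h1, mt hf.2 h1]

lemma noiseGain_congr {g g' : ℕ → Bool} {t : ℕ} (h : ∀ k < t + 1, g k = g' k) (j : Fin N) (V : ℝ) :
    noiseGain q pow v s2 g t j V = noiseGain q pow v s2 g' t j V := by
  have h' : ∀ k < t, g k = g' k := fun k hk => h k (by omega)
  have hf := isFirstUse_congr q h'
  simp only [noiseGain, active_congr q h', h t t.lt_succ_self]
  by_cases h1 : IsFirstUse q g t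
  · simp only [h1, hf.1 h1]
  · simp only [h1, mt hf.2 h1]

lemma errVar_congr {g g' : ℕ → Bool} {t : ℕ} (h : ∀ k < t, g k = g' k) (j : Fin N) :
    errVar q pow v s2 g t j = errVar q pow v s2 g' t j := by
  induction t with
  | zero => rfl
  | succ t ih =>
    simp only [errVar, ih fun k hk => h k (by omega), errGain_congr q pow v h j,
      noiseGain_congr q pow v s2 h j]

lemma frozenErr_congr {Ω : Type*} (x₀ : Ω → Fin N → ℝ) (n : ℕ → Ω → ℝ) {g g' : ℕ → Bool} {t : ℕ}
    (h : ∀ k < t, g k = g' k) (j : Fin N) :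
    frozenErr q pow v s2 x₀ n g t j = frozenErr q pow v s2 x₀ n g' t j := by
  induction t with
  | zero => rfl
  | succ t ih =>
    have h' : ∀ k < t, g k = g' k := fun k hk => h k (by omega)
    simp only [frozenErr, ih h', errVar_congr q pow v s2 h' j, errGain_congr q pow v h j,
      noiseGain_congr q pow v s2 h j]

lemma errVar_of_not_active {g : ℕ → Bool} {t : ℕ} {j : Fin N} (h : ∀ k < t, active q g k ≠ j) :
    errVar q pow v s2 g t j = s2 j := by
  induction t with
  | zero => rfl
  | succ t ih =>
    have h1 : ¬ j = active q g t := (h t t.lt_succ_self).symm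
    simp [errVar, errGain, noiseGain, h1, ih fun k hk => h k (by omega)]

lemma frozenErr_of_not_active {Ω : Type*} (x₀ : Ω → Fin N → ℝ) (n : ℕ → Ω → ℝ) {g : ℕ → Bool}
    {t : ℕ} {j : Fin N} (h : ∀ k < t, active q g k ≠ j) :
    frozenErr q pow v s2 x₀ n g t j = fun ω => -x₀ ω j := by
  induction t with
  | zero => rfl
  | succ t ih =>
    have h1 : ¬ j = active q g t := (h t t.lt_succ_self).symm
    simp [frozenErr, errGain, noiseGain, h1, ih fun k hk => h k (by omega)]

variable {pow v s2}

lemma errVar_succ_of_not_active {g : ℕ → Bool} {t : ℕ} {j : Fin N} (h : j ≠ active q g t) :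
    errVar q pow v s2 g (t + 1) j = errVar q pow v s2 g t j := by
  simp [errVar, errGain, noiseGain, h]

lemma errVar_succ_of_first (hpow : 0 < pow) (hs : ∀ j, 0 < s2 j) {g : ℕ → Bool} {t : ℕ} {j : Fin N}
    (h : j = active q g t) (hf : IsFirstUse q g t) :
    errVar q pow v s2 g (t + 1) j = (if g t = true then 0 else s2 j) + s2 j / pow * v := by
  have hV : errVar q pow v s2 g t j = s2 j := errVar_of_not_active q pow v s2 (h ▸ hf)
  have h0 : 0 ≤ s2 j / pow := (div_pos (hs j) hpow).le
  by_cases hg : g t = true <;>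
    simp [errVar, errGain, noiseGain, ← h, hf, hg, hV, Real.sq_sqrt h0]

/-- With `δ = v / (v + pow)`, the residual error and the injected noise contribute `δ² V` and `δ (1
- δ) V`, which add up to `δ V`. -/
lemma errVar_succ_of_later (hpow : 0 < pow) (hv : 0 < v) {g : ℕ → Bool} {t : ℕ} {j : Fin N}
    (h : j = active q g t) (hf : ¬ IsFirstUse q g t) (hV : 0 < errVar q pow v s2 g t j) :
    errVar q pow v s2 g (t + 1) j =
      (if g t = true then v / (v + pow) else 1) * errVar q pow v s2 g t j := by
  by_cases hg : g t = true
  · simp only [errVar, errGain, noiseGain, ← h, hf, hg, and_self, if_true, if_false]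
    set V := errVar q pow v s2 g t j
    have h0 : √(pow / V) ^ 2 = pow / V := Real.sq_sqrt (by positivity)
    have h1 : pow + v ≠ 0 := by positivity
    have h2 : v + pow ≠ 0 := by positivity
    rw [neg_sq, div_pow _ (pow + v), mul_pow, h0]
    field_simp
    ring
  · simp [errVar, errGain, noiseGain, ← h, hf, hg]

lemma errVar_pos (hpow : 0 < pow) (hv : 0 < v) (hs : ∀ j, 0 < s2 j) (g : ℕ → Bool) (t : ℕ)
    (j : Fin N) : 0 < errVar q pow v s2 g t j := by
  induction t with
  | zero => exact hs j
  | succ t ih =>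
    by_cases h : j = active q g t
    · by_cases hf : IsFirstUse q g t
      · rw [errVar_succ_of_first q hpow hs h hf]
        have h1 : 0 < s2 j / pow * v := mul_pos (div_pos (hs j) hpow) hv
        have h2 := hs j
        split_ifs <;> linarith
      · rw [errVar_succ_of_later q hpow hv h hf ih]
        split_ifs <;> positivity
    · rwa [errVar_succ_of_not_active q h]

/-- Every success contributes a factor `v / (v + pow)` to the error variance. -/
lemma errVar_le (hpow : 0 < pow) (hv : 0 < v) (hs : ∀ j, 0 < s2 j) (g : ℕ → Bool) (t : ℕ)
    (j : Fin N) : errVar q pow v s2 g t j ≤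
      s2 j * (1 + v / pow) / (v / (v + pow)) * (v / (v + pow)) ^ successCount q g j t := by
  set δ := v / (v + pow) with hδ
  have hδ0 : 0 < δ := by positivity
  have hδ1 : δ ≤ 1 := by rw [hδ, div_le_one (by positivity)]; linarith
  have hsj := hs j
  -- `C` is the variance after a dropped first slot, the only kind of slot that can raise it above
  -- its initial value without a success. The further division by `δ` is slack: it lets the first
  -- success go without credit.
  set C := s2 j * (1 + v / pow) with hC
  have hC0 : 0 < C := by positivity
  have hsC : s2 j ≤ C := le_mul_of_one_le_right hsj.le (by simp; positivity)
  have hCC : C ≤ C / δ := by rw [le_div_iff₀ hδ0]; nlinarith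
  induction t with
  | zero => simpa [errVar, successCount] using hsC.trans hCC
  | succ t ih =>
    rw [successCount_succ]
    by_cases h : j = active q g t
    · by_cases hf : IsFirstUse q g t
      · rw [errVar_succ_of_first q hpow hs h hf, successCount_eq_zero q (h ▸ hf)]
        have h1 : s2 j / pow * v = C - s2 j := by rw [hC]; field_simp; ring
        by_cases hg : g t = true
        · simp only [hg, h, and_self, if_true, zero_add, pow_one]
          rw [← h, div_mul_cancel₀ _ hδ0.ne', h1]
          linarith
        · simp only [hg, false_and, if_false, pow_zero, mul_one, h1, Bool.false_eq_true,
            zero_add]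
          linarith
      · rw [errVar_succ_of_later q hpow hv h hf (errVar_pos q hpow hv hs g t j)]
        by_cases hg : g t = true
        · simp only [hg, ← h, and_self, if_true, pow_succ]
          calc δ * errVar q pow v s2 g t j ≤ δ * (C / δ * δ ^ successCount q g j t) := by gcongr
            _ = _ := by ring
        · simpa [hg] using ih
    · rw [errVar_succ_of_not_active q h]
      simpa [Ne.symm h] using ih

/-- The initial state and the noise are centred, square integrable and uncorrelated. -/
structure IsUncorrelated {Ω : Type*} [MeasurableSpace Ω] (P : Measure Ω) (s2 : Fin N → ℝ) (v : ℝ)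
    (x₀ : Ω → Fin N → ℝ) (n : ℕ → Ω → ℝ) : Prop where
  memLp_init : ∀ j, MemLp (fun ω => x₀ ω j) 2 P
  memLp_noise : ∀ k, MemLp (n k) 2 P
  integral_init : ∀ j, ∫ ω, x₀ ω j ∂P = 0
  integral_noise : ∀ k, ∫ ω, n k ω ∂P = 0
  integral_init_sq : ∀ j, ∫ ω, x₀ ω j ^ 2 ∂P = s2 j
  integral_noise_sq : ∀ k, ∫ ω, n k ω ^ 2 ∂P = v
  integral_init_mul_noise : ∀ j k, ∫ ω, x₀ ω j * n k ω ∂P = 0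
  integral_noise_mul_noise : ∀ k l, k ≠ l → ∫ ω, n k ω * n l ω ∂P = 0

variable {Ω : Type*} [MeasurableSpace Ω] {P : Measure Ω}
  {x₀ : Ω → Fin N → ℝ} {n : ℕ → Ω → ℝ}

lemma integral_linear_sq {X Y : Ω → ℝ} (hX : MemLp X 2 P) (hY : MemLp Y 2 P) (a b : ℝ)
    (hXY : ∫ ω, X ω * Y ω ∂P = 0) :
    ∫ ω, (a * X ω + b * Y ω) ^ 2 ∂P = a ^ 2 * ∫ ω, X ω ^ 2 ∂P + b ^ 2 * ∫ ω, Y ω ^ 2 ∂P := by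
  have h1 : Integrable (fun ω => X ω * Y ω) P := hX.integrable_mul hY
  have e : (fun ω => (a * X ω + b * Y ω) ^ 2) =
      fun ω => (a ^ 2 * X ω ^ 2 + b ^ 2 * Y ω ^ 2) + 2 * a * b * (X ω * Y ω) := by
    funext ω; ring
  have h2 : Integrable (fun ω => a ^ 2 * X ω ^ 2 + b ^ 2 * Y ω ^ 2) P :=
    (hX.integrable_sq.const_mul _).add (hY.integrable_sq.const_mul _)
  rw [e, integral_add h2 (h1.const_mul _), integral_add (hX.integrable_sq.const_mul _) (hY.integrable_sq.const_mul _),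
    integral_const_mul, integral_const_mul, integral_const_mul, hXY, mul_zero, add_zero]

namespace IsUncorrelated

lemma memLp_frozenErr (h : IsUncorrelated P s2 v x₀ n) (g : ℕ → Bool) (t : ℕ) (j : Fin N) :
    MemLp (frozenErr q pow v s2 x₀ n g t j) 2 P := by
  induction t with
  | zero => exact (h.memLp_init j).neg
  | succ t ih => exact (ih.const_mul _).add ((h.memLp_noise t).const_mul _)

lemma integral_frozenErr [IsProbabilityMeasure P] (h : IsUncorrelated P s2 v x₀ n) (g : ℕ → Bool) (t : ℕ) (j : Fin N) :
    ∫ ω, frozenErr q pow v s2 x₀ n g t j ω ∂P = 0 := by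
  induction t with
  | zero => simp [frozenErr, integral_neg, h.integral_init]
  | succ t ih =>
    simp only [frozenErr]
    rw [integral_add (((h.memLp_frozenErr q g t j).integrable one_le_two).const_mul _)
      (((h.memLp_noise t).integrable one_le_two).const_mul _), integral_const_mul,
      integral_const_mul, ih, h.integral_noise, mul_zero, mul_zero, add_zero]

/-- The error before slot `t` is a combination of `x₀` and the noises of earlier slots only. -/
lemma integral_frozenErr_mul_noise (h : IsUncorrelated P s2 v x₀ n) (g : ℕ → Bool) (t : ℕ) (j : Fin N) (k : ℕ) (hk : t ≤ k) :
    ∫ ω, frozenErr q pow v s2 x₀ n g t j ω * n k ω ∂P = 0 := by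
  induction t with
  | zero => simp [frozenErr, integral_neg, h.integral_init_mul_noise]
  | succ t ih =>
    have h1 : Integrable (fun ω => frozenErr q pow v s2 x₀ n g t j ω * n k ω) P :=
      (h.memLp_frozenErr q g t j).integrable_mul (h.memLp_noise k)
    have h2 : Integrable (fun ω => n t ω * n k ω) P := (h.memLp_noise t).integrable_mul (h.memLp_noise k)
    simp only [frozenErr, add_mul, mul_assoc]
    rw [integral_add (h1.const_mul _) (h2.const_mul _), integral_const_mul, integral_const_mul,
      ih (by omega), h.integral_noise_mul_noise t k (by omega), mul_zero, mul_zero, add_zero]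

lemma integral_frozenErr_sq (h : IsUncorrelated P s2 v x₀ n) (g : ℕ → Bool) (t : ℕ) (j : Fin N) :
    ∫ ω, frozenErr q pow v s2 x₀ n g t j ω ^ 2 ∂P = errVar q pow v s2 g t j := by
  induction t with
  | zero => simp [frozenErr, h.integral_init_sq, errVar]
  | succ t ih =>
    simp only [frozenErr]
    rw [integral_linear_sq (h.memLp_frozenErr q g t j) (h.memLp_noise t) _ _
      (h.integral_frozenErr_mul_noise q g t j t le_rfl), ih, h.integral_noise_sq, errVar]

end IsUncorrelated

end Frozen

/-! ### Conditioning on the drop indicators -/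

section Sources

variable {Ω : Type*} {N : ℕ}

/-- What the initial state and the noise reveal. -/
@[reducible] def noiseSigma (x₀ : Ω → Fin N → ℝ) (n : ℕ → Ω → ℝ) : MeasurableSpace Ω :=
  MeasurableSpace.comap x₀ inferInstance ⊔ ⨆ t, MeasurableSpace.comap (n t) inferInstance

/-- The drop indicators of the slots `0, …, t - 1`. -/
def dropVec (γ : ℕ → Ω → Bool) (t : ℕ) (ω : Ω) (k : Fin t) : Bool := γ k ω

/-- A path of drop indicators with the given beginning. -/
def extendPath {t : ℕ} (g : Fin t → Bool) (k : ℕ) : Bool := if h : k < t then g ⟨k, h⟩ else false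

lemma extendPath_dropVec (γ : ℕ → Ω → Bool) (t : ℕ) (ω : Ω) :
    ∀ k < t, γ k ω = extendPath (dropVec γ t ω) k := fun k hk => by
  simp [extendPath, dropVec, hk]

lemma measurable_dropVec (γ : ℕ → Ω → Bool) (t : ℕ) : Measurable[dropHistory γ t] (dropVec γ t) :=
  @measurable_pi_lambda _ _ _ (dropHistory γ t) _ _ fun k =>
    Measurable.of_comap_le (le_iSup (fun k : Fin t => MeasurableSpace.comap (γ k) inferInstance) k)

/-- A quantity determined by the drop indicators before slot `t` is measurable with respect to
them. -/
lemma measurable_dropHistory_of_congr {α : Type*} [MeasurableSpace α] (γ : ℕ → Ω → Bool) (t : ℕ)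
    (F : (ℕ → Bool) → α) (hF : ∀ g g' : ℕ → Bool, (∀ k < t, g k = g' k) → F g = F g') :
    Measurable[dropHistory γ t] fun ω => F fun k => γ k ω := by
  have e : (fun ω => F fun k => γ k ω) = (fun g : Fin t → Bool => F (extendPath g)) ∘ dropVec γ t :=
    funext fun ω => hF _ _ (extendPath_dropVec γ t ω)
  rw [e]
  exact (Measurable.of_discrete).comp (measurable_dropVec γ t)

variable [MeasurableSpace Ω] {P : Measure Ω} {S₀ : Matrix (Fin N) (Fin N) ℝ} {ε : ℝ} {v : ℝ≥0}
  {x₀ : Ω → Fin N → ℝ} {γ : ℕ → Ω → Bool} {n : ℕ → Ω → ℝ}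

namespace IsSourceModel

lemma dropHistory_le (h : IsSourceModel P S₀ ε v x₀ γ n) (t : ℕ) :
    dropHistory γ t ≤ ‹MeasurableSpace Ω› :=
  iSup_le fun k => (h.measurable_drop k).comap_le

lemma noiseSigma_le (h : IsSourceModel P S₀ ε v x₀ γ n) : noiseSigma x₀ n ≤ ‹MeasurableSpace Ω› :=
  sup_le h.measurable_init.comap_le (iSup_le fun t => (h.measurable_noise t).comap_le)

lemma sourceSigma_le (h : IsSourceModel P S₀ ε v x₀ γ n) (i : Option (ℕ ⊕ ℕ)) :
    sourceSigma x₀ γ n i ≤ ‹MeasurableSpace Ω› := by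
  rcases i with _ | t | t
  exacts [h.measurable_init.comap_le, (h.measurable_drop t).comap_le,
    (h.measurable_noise t).comap_le]

lemma indep_noiseSigma_dropHistory (h : IsSourceModel P S₀ ε v x₀ γ n) (t : ℕ) :
    Indep (noiseSigma x₀ n) (dropHistory γ t) P := by
  have h1 := indep_iSup_of_disjoint h.sourceSigma_le h.indep
    (S := {i | ∀ k, i ≠ some (Sum.inl k)}) (T := {i | ∃ k, i = some (Sum.inl k)})
    (Set.disjoint_left.2 fun i hi ⟨k, hk⟩ => hi k hk)
  refine indep_of_indep_of_le_left (indep_of_indep_of_le_right h1 ?_) ?_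
  · exact iSup_le fun k => le_iSup₂_of_le (some (Sum.inl k.val)) ⟨k.val, rfl⟩ le_rfl
  · refine sup_le (le_iSup₂_of_le none (fun k => by simp) le_rfl) (iSup_le fun k => ?_)
    exact le_iSup₂_of_le (some (Sum.inr k)) (fun k => by simp) le_rfl

/-- Given the drop indicators, a function of them and of the independent noise has the
expectation that it has when the indicators are frozen. -/
lemma condExp_frozen [IsProbabilityMeasure P] (h : IsSourceModel P S₀ ε v x₀ γ n) (t : ℕ)
    (F : (ℕ → Bool) → Ω → ℝ) (hF : ∀ g g' : ℕ → Bool, (∀ k < t, g k = g' k) → F g = F g')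
    (hmeas : ∀ g, Measurable[noiseSigma x₀ n] (F g)) (hint : ∀ g, Integrable (F g) P) :
    Integrable (fun ω => F (fun k => γ k ω) ω) P ∧
    P[fun ω => F (fun k => γ k ω) ω | dropHistory γ t] =ᵐ[P]
      fun ω => ∫ ω', F (fun k => γ k ω) ω' ∂P := by
  -- The sample space is cut into the `2 ^ t` cylinders on which the prefix of the path is constant.
  -- The values of `extendPath` beyond `t` are immaterial by `hF`.
  set s : (Fin t → Bool) → Set Ω := fun g => dropVec γ t ⁻¹' {g}
  have hs : ∀ g, MeasurableSet[dropHistory γ t] (s g) := fun g =>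
    measurable_dropVec γ t (measurableSet_singleton g)
  have e : ∀ Φ : (ℕ → Bool) → Ω → ℝ, (∀ g g' : ℕ → Bool, (∀ k < t, g k = g' k) → Φ g = Φ g') →
      (fun ω => Φ (fun k => γ k ω) ω) = ∑ g, (s g).indicator (Φ (extendPath g)) := by
    intro Φ hΦ
    funext ω
    rw [hΦ _ _ (extendPath_dropVec γ t ω), Finset.sum_apply,
      Finset.sum_eq_single (dropVec γ t ω)]
    · simp [s]
    · intro g _ hg
      exact Set.indicator_of_notMem (fun hg' => hg hg'.symm) _
    · simp
  have hi : ∀ g ∈ Finset.univ, Integrable ((s g).indicator (F (extendPath g))) P := fun g _ =>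
    (hint _).indicator (h.dropHistory_le t _ (hs g))
  refine ⟨by rw [e F hF]; exact integrable_finsetSum' _ hi, ?_⟩
  rw [e F hF, e (fun g _ => ∫ ω', F g ω' ∂P) fun g g' hg => by rw [hF g g' hg]]
  refine (condExp_finsetSum hi _).trans ?_
  -- On a cylinder the indicator is known, and the frozen function is independent of the indicators,
  -- so its conditional expectation is its mean.
  have hae : ∀ g, P[(s g).indicator (F (extendPath g)) | dropHistory γ t] =ᵐ[P]
      (s g).indicator fun _ => ∫ ω', F (extendPath g) ω' ∂P := fun g => by
    refine (condExp_indicator (hint _) (hs g)).trans ?_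
    have := condExp_indep_eq h.noiseSigma_le (h.dropHistory_le t)
      (hmeas (extendPath g)).stronglyMeasurable (h.indep_noiseSigma_dropHistory t)
    filter_upwards [this] with ω hω
    simp only [Set.indicator, hω]
  filter_upwards [eventually_all.2 hae] with ω hω
  simp only [Finset.sum_apply, hω]

lemma integral_frozen [IsProbabilityMeasure P] (h : IsSourceModel P S₀ ε v x₀ γ n) (t : ℕ)
    (F : (ℕ → Bool) → Ω → ℝ) (hF : ∀ g g' : ℕ → Bool, (∀ k < t, g k = g' k) → F g = F g')
    (hmeas : ∀ g, Measurable[noiseSigma x₀ n] (F g)) (hint : ∀ g, Integrable (F g) P) :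
    ∫ ω, F (fun k => γ k ω) ω ∂P = ∫ ω, (∫ ω', F (fun k => γ k ω) ω' ∂P) ∂P := by
  rw [← integral_congr_ae (h.condExp_frozen t F hF hmeas hint).2,
    integral_condExp (h.dropHistory_le t)]

lemma memLp_frozen [IsProbabilityMeasure P] (h : IsSourceModel P S₀ ε v x₀ γ n) (t : ℕ)
    (F : (ℕ → Bool) → Ω → ℝ) (hF : ∀ g g' : ℕ → Bool, (∀ k < t, g k = g' k) → F g = F g')
    (hmeas : ∀ g, Measurable[noiseSigma x₀ n] (F g)) (hint : ∀ g, MemLp (F g) 2 P) :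
    MemLp (fun ω => F (fun k => γ k ω) ω) 2 P := by
  have h1 := (h.condExp_frozen t F hF hmeas fun g => (hint g).integrable one_le_two).1
  rw [memLp_two_iff_integrable_sq h1.aestronglyMeasurable]
  exact (h.condExp_frozen t (fun g ω => F g ω ^ 2) (fun g g' hg => by rw [hF g g' hg])
    (fun g => (hmeas g).pow_const 2) fun g => (hint g).integrable_sq).1

lemma map_init_eval (h : IsSourceModel P S₀ ε v x₀ γ n) (hS : S₀.PosDef) (j : Fin N) :
    P.map (fun ω => x₀ ω j) = gaussianReal 0 (S₀ j j).toNNReal := by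
  have h1 := (measurePreserving_eval_multivariateGaussian (μ := 0) hS.posSemidef (i := j)).map_eq
  have h2 : Measurable fun ω => WithLp.toLp 2 (x₀ ω) := by
    have := h.measurable_init
    fun_prop
  rw [← h.law_init, Measure.map_map (by fun_prop) h2] at h1
  exact h1

/-- Gaussianity serves only to give the first two moments. Correlations between different
coordinates of `x₀` play no role, because each coordinate is estimated separately. -/
lemma isUncorrelated [IsProbabilityMeasure P] (h : IsSourceModel P S₀ ε v x₀ γ n)
    (hS : S₀.PosDef) : IsUncorrelated P S₀.diag v x₀ n := by
  have mx : ∀ j, Measurable fun ω => x₀ ω j := fun j => (measurable_pi_apply j).comp h.measurable_init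
  have gauss : ∀ (X : Ω → ℝ) (w : ℝ≥0), Measurable X → P.map X = gaussianReal 0 w →
      MemLp X 2 P ∧ ∫ ω, X ω ∂P = 0 ∧ ∫ ω, X ω ^ 2 ∂P = w := by
    intro X w hX hmap
    have h1 : MemLp X 2 P := by
      have := memLp_id_gaussianReal (μ := 0) (v := w) 2
      rw [← hmap] at this
      exact this.comp_of_map hX.aemeasurable
    have h2 : ∫ ω, X ω ∂P = 0 := by
      have := integral_id_gaussianReal (μ := 0) (v := w)
      rwa [← hmap, integral_map hX.aemeasurable (by fun_prop)] at this
    refine ⟨h1, h2, ?_⟩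
    have := variance_id_gaussianReal (μ := 0) (v := w)
    rwa [← hmap, variance_map aemeasurable_id hX.aemeasurable, Function.id_comp,
      variance_of_integral_eq_zero hX.aemeasurable h2] at this
  have gx := fun j => gauss _ _ (mx j) (h.map_init_eval hS j)
  have gn := fun k => gauss _ _ (h.measurable_noise k) (h.law_noise k)
  refine ⟨fun j => (gx j).1, fun k => (gn k).1, fun j => (gx j).2.1, fun k => (gn k).2.1,
    fun j => ?_, fun k => (gn k).2.2, fun j k => ?_, fun k l hkl => ?_⟩
  · rw [(gx j).2.2, Real.coe_toNNReal _ hS.diag_pos.le, Matrix.diag_apply]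
  · have h1 : Indep _ _ P := h.indep.indep (i := none) (j := some (Sum.inr k)) (by simp)
    have h2 : IndepFun x₀ (n k) P := h1
    have h3 := h2.comp (measurable_pi_apply j) measurable_id
    have h4 := h3.integral_mul_eq_mul_integral (mx j).aestronglyMeasurable
      (h.measurable_noise k).aestronglyMeasurable
    refine h4.trans ?_
    have := (gn k).2.1
    simp only [Function.comp_def, id] at this ⊢
    rw [this, mul_zero]
  · have h1 : Indep _ _ P := h.indep.indep (i := some (Sum.inr k)) (j := some (Sum.inr l))
      (by simpa using hkl)
    have h2 : IndepFun (n k) (n l) P := h1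
    have h4 := h2.integral_mul_eq_mul_integral (h.measurable_noise k).aestronglyMeasurable
      (h.measurable_noise l).aestronglyMeasurable
    refine h4.trans ?_
    rw [(gn k).2.1, zero_mul]

lemma variance_init [IsProbabilityMeasure P] (h : IsSourceModel P S₀ ε v x₀ γ n)
    (hS : S₀.PosDef) (j : Fin N) : Var[fun ω => x₀ ω j; P] = S₀.diag j := by
  have hu := h.isUncorrelated hS
  rw [variance_of_integral_eq_zero (hu.memLp_init j).aemeasurable (hu.integral_init j),
    hu.integral_init_sq]

/-- The number of receptions has a binomial generating function. -/
lemma integral_pow_receptions [IsProbabilityMeasure P] (h : IsSourceModel P S₀ ε v x₀ γ n)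
    (hε0 : 0 ≤ ε) (hε1 : ε ≤ 1) (θ : ℝ) (t : ℕ) :
    ∫ ω, θ ^ (∑ k ∈ Finset.range t, if γ k ω = true then 1 else 0) ∂P =
      (ε + (1 - ε) * θ) ^ t := by
  have hf : Measurable fun b : Bool => if b = true then θ else 1 := Measurable.of_discrete
  have h1 : iIndepFun (fun k : Fin t => γ k) P := by
    have := h.indep.precomp (g := fun k : Fin t => some (Sum.inl k.val))
      (fun a b hab => by simpa [Fin.ext_iff] using hab)
    exact this
  have h2 := (h1.comp (fun _ b => if b = true then θ else 1) fun _ => hf)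
  have h3 := h2.integral_fun_prod_eq_prod_integral fun k =>
    (hf.comp (h.measurable_drop k)).aestronglyMeasurable
  have h4 : ∀ k, ∫ ω, ((fun b : Bool => if b = true then θ else 1) ∘ γ k) ω ∂P =
      ε + (1 - ε) * θ := by
    intro k
    have e : ((fun b : Bool => if b = true then θ else 1) ∘ γ k) =
        fun ω => {ω | γ k ω = false}.indicator (fun _ => (1 : ℝ)) ω +
          {ω | γ k ω = true}.indicator (fun _ => θ) ω := by
      funext ω
      by_cases hb : γ k ω = true <;> simp [Set.indicator, hb]
    have m0 : MeasurableSet {ω | γ k ω = false} := h.measurable_drop k (measurableSet_singleton _)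
    have m1 : MeasurableSet {ω | γ k ω = true} := h.measurable_drop k (measurableSet_singleton _)
    rw [e, integral_add ((integrable_const _).indicator m0) ((integrable_const _).indicator m1),
      integral_indicator_const _ m0, integral_indicator_const _ m1, measureReal_def,
      measureReal_def, h.law_received, h.law_dropped, ENNReal.toReal_ofReal hε0,
      ENNReal.toReal_ofReal (by linarith)]
    simp
  simp only [h4, Finset.prod_const, Finset.card_univ, Fintype.card_fin] at h3
  rw [← h3]
  refine integral_congr_ae (Eventually.of_forall fun ω => ?_)
  simp only [← Finset.prod_pow_eq_pow_sum, Function.comp_def]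
  rw [Finset.prod_range]
  refine Finset.prod_congr rfl fun k _ => ?_
  by_cases hb : γ k ω = true <;> simp [hb]

end IsSourceModel

end Sources

/-! ### The scheme follows the frozen error -/

section Identification

variable {Ω : Type*} {N : ℕ} [NeZero N] (q : Fin N → ℕ) (pow v : ℝ) (s2 : Fin N → ℝ)
  (x₀ : Ω → Fin N → ℝ) (n : ℕ → Ω → ℝ)

open Classical in
/-- The factor with which the scheduled error is transmitted. -/
def inputGain (g : ℕ → Bool) (t : ℕ) : ℝ :=
  -- The sign appears because the encoder sends `x₀` while the error before the first use is `-x₀`.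
  if IsFirstUse q g t then -√(pow / s2 (active q g t))
  else √(pow / errVar q pow v s2 g t (active q g t))

/-- The channel input along the path `g` of drop indicators. -/
def frozenInput (g : ℕ → Bool) (t : ℕ) (ω : Ω) : ℝ :=
  inputGain q pow v s2 g t * frozenErr q pow v s2 x₀ n g t (active q g t) ω

/-- The channel output along the path `g` of drop indicators. -/
def frozenOutput (g : ℕ → Bool) (t : ℕ) (ω : Ω) : ℝ :=
  ((if g t = true then 1 else 0) * inputGain q pow v s2 g t) *
    frozenErr q pow v s2 x₀ n g t (active q g t) ω + 1 * n t ω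

lemma inputGain_congr {g g' : ℕ → Bool} {t : ℕ} (h : ∀ k < t, g k = g' k) :
    inputGain q pow v s2 g t = inputGain q pow v s2 g' t := by
  have hf := isFirstUse_congr q h
  simp only [inputGain, active_congr q h, errVar_congr q pow v s2 h]
  by_cases h1 : IsFirstUse q g t
  · simp only [h1, hf.1 h1]
  · simp only [h1, mt hf.2 h1]

lemma frozenInput_congr {g g' : ℕ → Bool} {t : ℕ} (h : ∀ k < t, g k = g' k) :
    frozenInput q pow v s2 x₀ n g t = frozenInput q pow v s2 x₀ n g' t := by
  funext ω
  simp only [frozenInput, inputGain_congr q pow v s2 h, active_congr q h,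
    frozenErr_congr q pow v s2 x₀ n h]

lemma frozenOutput_congr {g g' : ℕ → Bool} {t : ℕ} (h : ∀ k < t + 1, g k = g' k) :
    frozenOutput q pow v s2 x₀ n g t = frozenOutput q pow v s2 x₀ n g' t := by
  have h' : ∀ k < t, g k = g' k := fun k hk => h k (by omega)
  funext ω
  simp only [frozenOutput, inputGain_congr q pow v s2 h', active_congr q h',
    frozenErr_congr q pow v s2 x₀ n h', h t t.lt_succ_self]

lemma measurable_frozenErr (g : ℕ → Bool) (t : ℕ) (j : Fin N) :
    Measurable[noiseSigma x₀ n] (frozenErr q pow v s2 x₀ n g t j) := by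
  let _ := noiseSigma x₀ n
  have hx : Measurable x₀ := Measurable.of_comap_le le_sup_left
  have hn : ∀ k, Measurable (n k) := fun k => Measurable.of_comap_le
    ((le_iSup (fun t => MeasurableSpace.comap (n t) inferInstance) k).trans le_sup_right)
  induction t with
  | zero => exact ((measurable_pi_apply j).comp hx).neg
  | succ t ih => exact (ih.const_mul _).add ((hn t).const_mul _)

lemma measurable_frozenInput (g : ℕ → Bool) (t : ℕ) :
    Measurable[noiseSigma x₀ n] (frozenInput q pow v s2 x₀ n g t) :=
  (measurable_frozenErr q pow v s2 x₀ n g t _).const_mul _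

lemma measurable_frozenOutput (g : ℕ → Bool) (t : ℕ) :
    Measurable[noiseSigma x₀ n] (frozenOutput q pow v s2 x₀ n g t) := by
  have hn : Measurable[noiseSigma x₀ n] (n t) := Measurable.of_comap_le
    ((le_iSup (fun t => MeasurableSpace.comap (n t) inferInstance) t).trans le_sup_right)
  exact ((measurable_frozenErr q pow v s2 x₀ n g t _).const_mul _).add (hn.const_mul _)

variable {pow v s2}

/-- The input is normalised on every path separately, so the power constraint holds with equality
even given the drop indicators. -/
lemma inputGain_sq (hpow : 0 < pow) (hv : 0 < v) (hs : ∀ j, 0 < s2 j) (g : ℕ → Bool) (t : ℕ) :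
    inputGain q pow v s2 g t ^ 2 * errVar q pow v s2 g t (active q g t) = pow := by
  have hV := errVar_pos q hpow hv hs g t (active q g t)
  unfold inputGain
  split_ifs with hf
  · rw [errVar_of_not_active q pow v s2 hf] at hV ⊢
    rw [neg_sq, Real.sq_sqrt (by positivity), div_mul_cancel₀ _ hV.ne']
  · rw [Real.sq_sqrt (by positivity), div_mul_cancel₀ _ hV.ne']

variable {x₀ n} [MeasurableSpace Ω] {P : Measure Ω}

namespace IsUncorrelated

lemma memLp_frozenInput (h : IsUncorrelated P s2 v x₀ n) (g : ℕ → Bool) (t : ℕ) :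
    MemLp (frozenInput q pow v s2 x₀ n g t) 2 P :=
  (h.memLp_frozenErr q g t _).const_mul _

lemma memLp_frozenOutput (h : IsUncorrelated P s2 v x₀ n) (g : ℕ → Bool) (t : ℕ) :
    MemLp (frozenOutput q pow v s2 x₀ n g t) 2 P :=
  ((h.memLp_frozenErr q g t _).const_mul _).add ((h.memLp_noise t).const_mul _)

lemma integral_frozenInput_sq (h : IsUncorrelated P s2 v x₀ n) (hpow : 0 < pow) (hv : 0 < v)
    (hs : ∀ j, 0 < s2 j) (g : ℕ → Bool) (t : ℕ) :
    ∫ ω, frozenInput q pow v s2 x₀ n g t ω ^ 2 ∂P = pow := by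
  simp only [frozenInput, mul_pow]
  rw [integral_const_mul, h.integral_frozenErr_sq, inputGain_sq q hpow hv hs]

lemma integral_frozenOutput_sq (h : IsUncorrelated P s2 v x₀ n) (hpow : 0 < pow) (hv : 0 < v)
    (hs : ∀ j, 0 < s2 j) (g : ℕ → Bool) (t : ℕ) :
    ∫ ω, frozenOutput q pow v s2 x₀ n g t ω ^ 2 ∂P =
      (if g t = true then 1 else 0) * pow + v := by
  simp only [frozenOutput]
  rw [integral_linear_sq (h.memLp_frozenErr q g t _) (h.memLp_noise t) _ _
    (h.integral_frozenErr_mul_noise q g t _ t le_rfl), h.integral_frozenErr_sq,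
    h.integral_noise_sq, mul_pow, mul_assoc, inputGain_sq q hpow hv hs]
  split_ifs <;> simp

lemma integral_frozenOutput_mul_frozenErr (h : IsUncorrelated P s2 v x₀ n) (g : ℕ → Bool) (t : ℕ) :
    ∫ ω, frozenOutput q pow v s2 x₀ n g t ω *
        frozenErr q pow v s2 x₀ n g t (active q g t) ω ∂P =
      (if g t = true then 1 else 0) * inputGain q pow v s2 g t *
        errVar q pow v s2 g t (active q g t) := by
  set a := (if g t = true then 1 else 0) * inputGain q pow v s2 g t with ha
  have h1 := h.memLp_frozenErr (pow := pow) q g t (active q g t)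
  have h2 : Integrable (fun ω => frozenErr q pow v s2 x₀ n g t (active q g t) ω * n t ω) P :=
    h1.integrable_mul (h.memLp_noise t)
  have e : (fun ω => frozenOutput q pow v s2 x₀ n g t ω *
        frozenErr q pow v s2 x₀ n g t (active q g t) ω) = fun ω =>
      a * frozenErr q pow v s2 x₀ n g t (active q g t) ω ^ 2 +
        frozenErr q pow v s2 x₀ n g t (active q g t) ω * n t ω := by
    funext ω
    rw [frozenOutput, ← ha]
    ring
  rw [e, integral_add (h1.integrable_sq.const_mul _) h2, integral_const_mul,
    h.integral_frozenErr_sq, h.integral_frozenErr_mul_noise q g t _ t le_rfl, add_zero]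

end IsUncorrelated

variable [IsProbabilityMeasure P] {S₀ : Matrix (Fin N) (Fin N) ℝ} {ε : ℝ} {w : ℝ≥0}
  {γ : ℕ → Ω → Bool}

namespace IsSourceModel

/-- The conditional mean of the error vanishes, so its conditional variance is the conditional
second moment, which freezing evaluates. The encoder's random scaling thereby becomes an explicit
function of the path. -/
lemma condVar_err_ae (h : IsSourceModel P S₀ ε w x₀ γ n) (hS : S₀.PosDef) {t : ℕ}
    {y : Ω → Fin N → ℝ} (j : Fin N)
    (hy : ∀ᵐ ω ∂P, y ω j - x₀ ω j =
      frozenErr q pow w S₀.diag x₀ n (fun k => γ k ω) t j ω) :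
    Var[fun ω => y ω j - x₀ ω j; P | dropHistory γ t] =ᵐ[P]
      fun ω => errVar q pow w S₀.diag (fun k => γ k ω) t j := by
  have hu := h.isUncorrelated hS
  have hmean := (h.condExp_frozen t (fun g => frozenErr q pow w S₀.diag x₀ n g t j)
    (fun _ _ hg => frozenErr_congr q _ _ _ x₀ n hg j)
    (fun g => measurable_frozenErr q _ _ _ x₀ n g t j)
    (fun g => (hu.memLp_frozenErr q g t j).integrable one_le_two)).2
  have hsq := (h.condExp_frozen t
    (fun g ω => frozenErr q pow w S₀.diag x₀ n g t j ω ^ 2)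
    (fun g g' hg => by rw [frozenErr_congr q _ _ _ x₀ n hg j])
    (fun g => (measurable_frozenErr q _ _ _ x₀ n g t j).pow_const 2)
    (fun g => (hu.memLp_frozenErr q g t j).integrable_sq)).2
  simp only [hu.integral_frozenErr (pow := pow) q] at hmean
  simp only [hu.integral_frozenErr_sq (pow := pow) q] at hsq
  refine (condVar_congr_ae hy).trans (EventuallyEq.trans ?_ hsq)
  refine condExp_congr_ae ?_
  filter_upwards [hmean] with ω hω
  simp [hω]

lemma encode_ae (h : IsSourceModel P S₀ ε w x₀ γ n) (hS : S₀.PosDef) {t : ℕ}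
    {y : Ω → Fin N → ℝ} (hy : ∀ᵐ ω ∂P, ∀ j, y ω j - x₀ ω j =
      frozenErr q pow w S₀.diag x₀ n (fun k => γ k ω) t j ω) :
    ∀ᵐ ω ∂P, encode P pow q x₀ γ t y ω =
      frozenInput q pow w S₀.diag x₀ n (fun k => γ k ω) t ω := by
  have hvar := eventually_all.2 fun j => h.condVar_err_ae q hS j (hy.mono fun ω hω => hω j)
  filter_upwards [hy, hvar] with ω h1 h2
  by_cases hf : IsFirstUse q (fun k => γ k ω) t
  · simp only [encode, frozenInput, inputGain, hf, if_true, h.variance_init hS,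
      frozenErr_of_not_active q pow w S₀.diag x₀ n hf]
    ring
  · simp only [encode, frozenInput, inputGain, hf, if_false, h2, h1]

/-- Before every slot the estimation error is the frozen error for the actual path of drop
indicators. -/
lemma estimate_ae (h : IsSourceModel P S₀ ε w x₀ γ n) (hS : S₀.PosDef) (hpow : 0 < pow)
    (hw : 0 < w) (t : ℕ) :
    ∀ᵐ ω ∂P, ∀ j, estimate P pow q x₀ γ n t ω j - x₀ ω j =
      frozenErr q pow w S₀.diag x₀ n (fun k => γ k ω) t j ω := by
  have hu := h.isUncorrelated hS
  have hs : ∀ j, 0 < S₀.diag j := fun j => hS.diag_pos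
  have hw' : (0 : ℝ) < w := hw
  induction t with
  | zero => simp [estimate, frozenErr]
  | succ t ih =>
    set s2 : Fin N → ℝ := S₀.diag with hs2
    set r := transmit γ n t (encode P pow q x₀ γ t (estimate P pow q x₀ γ n t)) with hr
    have hrae : ∀ᵐ ω ∂P, r ω = frozenOutput q pow w s2 x₀ n (fun k => γ k ω) t ω := by
      filter_upwards [h.encode_ae q hS ih] with ω hω
      simp only [hr, transmit, hω, frozenInput, frozenOutput]
      ring
    -- The conditioning reaches slot `t` itself, since the output depends on whether that slot was
    -- received.
    have hcov : ∀ᵐ ω ∂P, ∀ j,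
        (P[fun ω' => r ω' * (estimate P pow q x₀ γ n t ω' j - x₀ ω' j) | dropHistory γ (t + 1)]) ω =
        ∫ ω', frozenOutput q pow w s2 x₀ n (fun k => γ k ω) t ω' *
          frozenErr q pow w s2 x₀ n (fun k => γ k ω) t j ω' ∂P := by
      refine eventually_all.2 fun j => ?_
      refine EventuallyEq.trans (condExp_congr_ae ?_) (h.condExp_frozen (t + 1)
        (fun g ω => frozenOutput q pow w s2 x₀ n g t ω * frozenErr q pow w s2 x₀ n g t j ω)
        (fun g g' hg => by
          rw [frozenOutput_congr q _ _ _ x₀ n hg,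
            frozenErr_congr q _ _ _ x₀ n (fun k hk => hg k (by omega)) j])
        (fun g => (measurable_frozenOutput q _ _ _ x₀ n g t).mul
          (measurable_frozenErr q _ _ _ x₀ n g t j))
        (fun g => (hu.memLp_frozenOutput q g t).integrable_mul (hu.memLp_frozenErr q g t j))).2
      filter_upwards [hrae, ih] with ω h1 h2
      rw [h1, h2]
    have hsq : ∀ᵐ ω ∂P, (P[fun ω' => r ω' ^ 2 | dropHistory γ (t + 1)]) ω =
        ∫ ω', frozenOutput q pow w s2 x₀ n (fun k => γ k ω) t ω' ^ 2 ∂P := by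
      refine EventuallyEq.trans (condExp_congr_ae ?_) (h.condExp_frozen (t + 1)
        (fun g ω => frozenOutput q pow w s2 x₀ n g t ω ^ 2)
        (fun g g' hg => by rw [frozenOutput_congr q _ _ _ x₀ n hg])
        (fun g => (measurable_frozenOutput q _ _ _ x₀ n g t).pow_const 2)
        (fun g => (hu.memLp_frozenOutput q g t).integrable_sq)).2
      filter_upwards [hrae] with ω h1
      rw [h1]
    filter_upwards [ih, hrae, hcov, hsq] with ω h1 h2 h3 h4 j
    set g : ℕ → Bool := fun k => γ k ω with hg
    change decode P pow q x₀ γ t (estimate P pow q x₀ γ n t) r ω j - x₀ ω j = _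
    by_cases hj : j = active q g t
    · by_cases hf : IsFirstUse q g t
      · have hfe := frozenErr_of_not_active q pow w s2 x₀ n hf
        have hsj := hs (active q g t)
        have h5 : √(s2 (active q g t) / pow) * √(pow / s2 (active q g t)) = 1 := by
          rw [← Real.sqrt_mul (by positivity), div_mul_div_cancel₀ hpow.ne', div_self hsj.ne',
            Real.sqrt_one]
        subst hj
        simp only [decode, ← hg, if_true, hf, h.variance_init hS, h2, frozenOutput, frozenErr,
          hfe, inputGain, errGain, noiseGain, true_and, one_mul]
        by_cases hgt : g t = true
        · simp only [hgt, if_true]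
          linear_combination (x₀ ω (active q g t)) * h5
        · simp only [hgt, Bool.false_eq_true, if_false]
          ring
      · simp only [decode, ← hg, if_pos hj, if_neg hf, h3, h4]
        subst hj
        rw [hu.integral_frozenOutput_mul_frozenErr, hu.integral_frozenOutput_sq q hpow hw' hs, h2]
        have h6 : estimate P pow q x₀ γ n t ω (active q g t) =
            frozenErr q pow w s2 x₀ n g t (active q g t) ω + x₀ ω (active q g t) := by
          rw [← h1]; ring
        rw [h6]
        simp only [frozenErr, errGain, noiseGain, frozenOutput, hf, if_true, if_false, true_and,
          one_mul]
        -- On reception the identity reduces to `1 - c² V / (pow + w) = w / (pow + w)`, by the power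
        -- normalisation `c² V = pow`.
        by_cases hgt : g t = true
        · have h7 := inputGain_sq q hpow hw' hs g t
          have h8 : inputGain q pow w s2 g t = √(pow / errVar q pow w s2 g t (active q g t)) := by
            simp [inputGain, hf]
          simp only [hgt, if_true, one_mul, ← h8]
          set V := errVar q pow w s2 g t (active q g t)
          set c := inputGain q pow w s2 g t
          set f := frozenErr q pow w s2 x₀ n g t (active q g t) ω
          have h9 : pow + (w : ℝ) ≠ 0 := by positivity
          rw [add_comm (w : ℝ) pow]
          field_simp
          linear_combination (-f) * h7
        · simp [hgt]
    · simp only [decode, ← hg, frozenErr, errGain, noiseGain, hj, false_and, if_false]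
      rw [h1]
      ring

lemma channelInput_ae (h : IsSourceModel P S₀ ε w x₀ γ n) (hS : S₀.PosDef) (hpow : 0 < pow)
    (hw : 0 < w) (t : ℕ) : ∀ᵐ ω ∂P, channelInput P pow q x₀ γ n t ω =
      frozenInput q pow w S₀.diag x₀ n (fun k => γ k ω) t ω :=
  h.encode_ae q hS (h.estimate_ae q hS hpow hw t)

lemma memLp_channelInput (h : IsSourceModel P S₀ ε w x₀ γ n) (hS : S₀.PosDef) (hpow : 0 < pow)
    (hw : 0 < w) (t : ℕ) : MemLp (channelInput P pow q x₀ γ n t) 2 P :=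
  (memLp_congr_ae (h.channelInput_ae q hS hpow hw t)).2
    (h.memLp_frozen t (fun g => frozenInput q pow w S₀.diag x₀ n g t)
      (fun _ _ hg => frozenInput_congr q _ _ _ x₀ n hg)
      (fun g => measurable_frozenInput q _ _ _ x₀ n g t)
      fun g => (h.isUncorrelated hS).memLp_frozenInput q g t)

lemma integral_channelInput_sq (h : IsSourceModel P S₀ ε w x₀ γ n) (hS : S₀.PosDef)
    (hpow : 0 < pow) (hw : 0 < w) (t : ℕ) :
    ∫ ω, channelInput P pow q x₀ γ n t ω ^ 2 ∂P = pow := by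
  have hu := h.isUncorrelated hS
  have h1 := h.integral_frozen t
    (fun g ω => frozenInput q pow w S₀.diag x₀ n g t ω ^ 2)
    (fun g g' hg => by rw [frozenInput_congr q _ _ _ x₀ n hg])
    (fun g => (measurable_frozenInput q _ _ _ x₀ n g t).pow_const 2)
    fun g => (hu.memLp_frozenInput q g t).integrable_sq
  simp only [hu.integral_frozenInput_sq q hpow hw fun j => hS.diag_pos] at h1
  rw [integral_congr_ae ((h.channelInput_ae q hS hpow hw t).mono fun _ hω => by
    simp only [hω]; rfl), h1]
  simp

lemma memLp_estimate_sub (h : IsSourceModel P S₀ ε w x₀ γ n) (hS : S₀.PosDef) (hpow : 0 < pow)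
    (hw : 0 < w) (t : ℕ) (j : Fin N) :
    MemLp (fun ω => estimate P pow q x₀ γ n t ω j - x₀ ω j) 2 P :=
  (memLp_congr_ae ((h.estimate_ae q hS hpow hw t).mono fun _ hω => hω j)).2
    (h.memLp_frozen t (fun g => frozenErr q pow w S₀.diag x₀ n g t j)
      (fun _ _ hg => frozenErr_congr q _ _ _ x₀ n hg j)
      (fun g => measurable_frozenErr q _ _ _ x₀ n g t j)
      fun g => (h.isUncorrelated hS).memLp_frozenErr q g t j)

lemma integral_estimate_sub_sq (h : IsSourceModel P S₀ ε w x₀ γ n) (hS : S₀.PosDef)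
    (hpow : 0 < pow) (hw : 0 < w) (t : ℕ) (j : Fin N) :
    ∫ ω, (estimate P pow q x₀ γ n t ω j - x₀ ω j) ^ 2 ∂P =
      ∫ ω, errVar q pow w S₀.diag (fun k => γ k ω) t j ∂P := by
  have hu := h.isUncorrelated hS
  have h1 := h.integral_frozen t
    (fun g ω => frozenErr q pow w S₀.diag x₀ n g t j ω ^ 2)
    (fun g g' hg => by rw [frozenErr_congr q _ _ _ x₀ n hg j])
    (fun g => (measurable_frozenErr q _ _ _ x₀ n g t j).pow_const 2)
    fun g => (hu.memLp_frozenErr q g t j).integrable_sq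
  simp only [hu.integral_frozenErr_sq (pow := pow) q] at h1
  rw [← h1]
  exact integral_congr_ae ((h.estimate_ae q hS hpow hw t).mono fun _ hω => by simp only [hω])

end IsSourceModel

end Identification

/-! ### Causality -/

lemma measurable_select {Ω ι : Type*} [Fintype ι] [DecidableEq ι] [MeasurableSpace ι]
    [MeasurableSingletonClass ι] {m : MeasurableSpace Ω} {J : Ω → ι} {f : ι → Ω → ℝ}
    (hJ : Measurable J) (hf : ∀ j, Measurable (f j)) : Measurable fun ω => f (J ω) ω := by
  have e : (fun ω => f (J ω) ω) = fun ω => ∑ j, if J ω = j then f j ω else 0 := by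
    funext ω
    simp
  rw [e]
  exact Finset.measurable_sum _ fun j _ =>
    Measurable.ite (hJ (measurableSet_singleton j)) (hf j) measurable_const

section Causality

variable {Ω : Type*} {N : ℕ} [NeZero N] (q : Fin N → ℕ) (γ : ℕ → Ω → Bool)

lemma measurable_active (t : ℕ) : Measurable[dropHistory γ t] fun ω => active q (fun k => γ k ω) t :=
  measurable_dropHistory_of_congr γ t (fun g => active q g t) fun _ _ h => active_congr q h

lemma measurableSet_isFirstUse (t : ℕ) :
    MeasurableSet[dropHistory γ t] {ω | IsFirstUse q (fun k => γ k ω) t} := by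
  have h := measurable_dropHistory_of_congr γ t (fun g => IsFirstUse q g t)
    fun _ _ h => propext (isFirstUse_congr q h)
  exact @measurableSet_setOfPred _ (dropHistory γ t) _ |>.2 h

lemma dropHistory_le_outputHistory (r : ℕ → Ω → ℝ) (t : ℕ) :
    dropHistory γ t ≤ outputHistory γ r t :=
  iSup_mono fun _ => le_sup_right

lemma outputHistory_mono (r : ℕ → Ω → ℝ) {s t : ℕ} (h : s ≤ t) :
    outputHistory γ r s ≤ outputHistory γ r t :=
  iSup_le fun k => le_iSup_of_le (Fin.castLE h k) le_rfl

lemma dropHistory_mono {s t : ℕ} (h : s ≤ t) : dropHistory γ s ≤ dropHistory γ t :=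
  iSup_le fun k => le_iSup_of_le (Fin.castLE h k) le_rfl

lemma measurable_output (r : ℕ → Ω → ℝ) (t : ℕ) : Measurable[outputHistory γ r (t + 1)] (r t) :=
  Measurable.of_comap_le (le_iSup_of_le (Fin.last t) le_sup_left)

lemma measurable_encode {m : MeasurableSpace Ω} [MeasurableSpace Ω] (P : Measure Ω)
    (pow : ℝ) (x₀ : Ω → Fin N → ℝ) (t : ℕ) (y : Ω → Fin N → ℝ)
    (hm : dropHistory γ t ≤ m) (hx : ∀ j, Measurable[m] fun ω => x₀ ω j)
    (hy : ∀ j, Measurable[m] fun ω => y ω j) : Measurable[m] (encode P pow q x₀ γ t y) := by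
  have hact := (measurable_active q γ t).mono hm le_rfl
  unfold encode
  refine Measurable.ite (hm _ (measurableSet_isFirstUse q γ t)) ?_ ?_
  · exact measurable_select (f := fun j ω => √(pow / Var[fun ω' => x₀ ω' j; P]) * x₀ ω j) hact
      fun j => (hx j).const_mul _
  · refine measurable_select (f := fun j ω =>
      √(pow / (Var[fun ω' => y ω' j - x₀ ω' j; P | dropHistory γ t]) ω) * (y ω j - x₀ ω j)) hact
      fun j => ?_
    have hV : Measurable[m] (Var[fun ω' => y ω' j - x₀ ω' j; P | dropHistory γ t]) :=
      (stronglyMeasurable_condVar.mono hm).measurable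
    exact ((measurable_const.div hV).sqrt).mul ((hy j).sub (hx j))

variable [MeasurableSpace Ω] (P : Measure Ω) (pow : ℝ) (x₀ : Ω → Fin N → ℝ) (n : ℕ → Ω → ℝ)

lemma measurable_estimate (t : ℕ) (j : Fin N) :
    Measurable[outputHistory γ (channelOutput P pow q x₀ γ n) t]
      fun ω => estimate P pow q x₀ γ n t ω j := by
  induction t generalizing j with
  | zero => exact @measurable_const _ _ _ _ _
  | succ t ih =>
    set r := channelOutput P pow q x₀ γ n with hr
    have e : (fun ω => estimate P pow q x₀ γ n (t + 1) ω j) =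
      fun ω => decode P pow q x₀ γ t (estimate P pow q x₀ γ n t) (r t) ω j := rfl
    have hle : dropHistory γ (t + 1) ≤ outputHistory γ r (t + 1) :=
      dropHistory_le_outputHistory γ r (t + 1)
    have hle' : dropHistory γ t ≤ outputHistory γ r (t + 1) := (dropHistory_mono γ t.le_succ).trans hle
    have hrt := measurable_output γ r t
    have hy := (ih j).mono (outputHistory_mono γ r t.le_succ) le_rfl
    rw [e]
    unfold decode
    have hact : MeasurableSet[outputHistory γ r (t + 1)] {ω | j = active q (fun k => γ k ω) t} := by
      have := hle' _ (measurable_active q γ t (measurableSet_singleton j))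
      convert this using 1
      ext ω
      simp [eq_comm]
    refine Measurable.ite hact (Measurable.ite (hle' _ (measurableSet_isFirstUse q γ t))
      (hrt.const_mul _) (hy.sub (Measurable.mul (Measurable.div ?_ ?_) hrt))) hy
    · exact (stronglyMeasurable_condExp.mono hle).measurable
    · exact (stronglyMeasurable_condExp.mono hle).measurable

lemma measurable_channelInput (A : Matrix (Fin N) (Fin N) ℝ) (B K : Fin N → ℝ) (t : ℕ) :
    Measurable[stateHistory (state P pow q x₀ γ n A B K) t ⊔
      outputHistory γ (channelOutput P pow q x₀ γ n) t] (channelInput P pow q x₀ γ n t) := by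
  refine measurable_encode q γ P pow x₀ t _
    ((dropHistory_le_outputHistory γ _ t).trans le_sup_right) (fun j => ?_) fun j =>
    (measurable_estimate q γ P pow x₀ n t j).mono le_sup_right le_rfl
  have h : Measurable[stateHistory (state P pow q x₀ γ n A B K) t ⊔
      outputHistory γ (channelOutput P pow q x₀ γ n) t] x₀ :=
    Measurable.of_comap_le (le_sup_of_le_left (le_iSup (fun k : Fin (t + 1) =>
      MeasurableSpace.comap (state P pow q x₀ γ n A B K k) inferInstance) 0))
  exact (measurable_pi_apply j).comp h

lemma measurable_control (A : Matrix (Fin N) (Fin N) ℝ) (B K : Fin N → ℝ) (t : ℕ) :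
    Measurable[outputHistory γ (channelOutput P pow q x₀ γ n) (t + 1)]
      (control P pow q x₀ γ n A B K t) := by
  induction t using Nat.strong_induction_on with
  | _ t ih =>
    set r := channelOutput P pow q x₀ γ n with hr
    have e : control P pow q x₀ γ n A B K t = fun ω => ∑ i, K i *
        (∑ j, (A ^ t) i j * estimate P pow q x₀ γ n (t + 1) ω j +
          ∑ k : Fin t, control P pow q x₀ γ n A B K k ω * (A ^ (t - 1 - k.val) *ᵥ B) i) := by
      funext ω
      rw [control]
      simp [dotProduct, Matrix.mulVec, Finset.sum_apply]
    rw [e]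
    refine Finset.measurable_sum _ fun i _ => Measurable.const_mul (Measurable.add ?_ ?_) _
    · exact Finset.measurable_sum _ fun j _ =>
        (measurable_estimate q γ P pow x₀ n (t + 1) j).const_mul _
    · exact Finset.measurable_sum _ fun k _ =>
        ((ih k k.isLt).mono (outputHistory_mono γ r (by have := k.isLt; omega)) le_rfl).mul_const _

/-! ### The closed loop -/

variable (A : Matrix (Fin N) (Fin N) ℝ) (B K : Fin N → ℝ)

lemma state_eq_sum (t : ℕ) (ω : Ω) :
    state P pow q x₀ γ n A B K t ω = A ^ t *ᵥ x₀ ω +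
      ∑ k : Fin t, control P pow q x₀ γ n A B K k ω • (A ^ (t - 1 - k.val) *ᵥ B) := by
  induction t with
  | zero => simp [state]
  | succ t ih =>
    simp only [state]
    rw [ih, Fin.sum_univ_castSucc, Matrix.mulVec_add, Matrix.mulVec_mulVec, ← pow_succ',
      add_assoc]
    congr 1
    rw [Matrix.mulVec_sum]
    congr 1
    · refine Finset.sum_congr rfl fun k _ => ?_
      have : t + 1 - 1 - (Fin.castSucc k).val = (t - 1 - k.val) + 1 := by
        have := k.isLt
        simp only [Fin.val_castSucc]
        omega
      rw [this, Matrix.mulVec_smul, Matrix.mulVec_mulVec, ← pow_succ']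
      rfl
    · simp

/-- The perturbation of the closed loop caused by the estimation error. -/
def loopNoise (t : ℕ) (ω : Ω) : ℝ :=
  K ⬝ᵥ (A ^ t *ᵥ fun j => estimate P pow q x₀ γ n (t + 1) ω j - x₀ ω j)

/-- By `state_eq_sum` the vector fed to `K` is `x_t + A ^ t (x̂_t - x₀)`: the initial state is
replaced by its estimate and the effect of past controls is exact. -/
lemma state_succ (t : ℕ) (ω : Ω) :
    state P pow q x₀ γ n A B K (t + 1) ω =
      (A + Matrix.vecMulVec B K) *ᵥ state P pow q x₀ γ n A B K t ω +
        loopNoise q γ P pow x₀ n A K t ω • B := by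
  have e : (fun j => estimate P pow q x₀ γ n (t + 1) ω j - x₀ ω j) =
    estimate P pow q x₀ γ n (t + 1) ω - x₀ ω := rfl
  have hc : control P pow q x₀ γ n A B K t ω =
      K ⬝ᵥ state P pow q x₀ γ n A B K t ω + loopNoise q γ P pow x₀ n A K t ω := by
    rw [control, state_eq_sum, loopNoise, e, Matrix.mulVec_sub, ← dotProduct_add]
    congr 1
    abel
  simp only [state]
  rw [hc, Matrix.add_mulVec, add_smul, add_assoc]
  congr 2
  funext i
  simp [Matrix.mulVec, Matrix.vecMulVec_apply, dotProduct, Finset.sum_mul]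
  refine Finset.sum_congr rfl fun j _ => by ring

end Causality

/-! ### Stable recursions driven by a vanishing input -/

/-- The scalar majorant `z (t + 1) = ρ z t + b |w t|` of a stable linear recursion driven by `w`. -/
def majorant (ρ b z₀ : ℝ) (w : ℕ → ℝ) : ℕ → ℝ
  | 0 => z₀
  | t + 1 => ρ * majorant ρ b z₀ w t + b * |w t|

lemma abs_le_majorant {N : ℕ} {F : Matrix (Fin N) (Fin N) ℝ} {C ρ : ℝ}
    (hF : ∀ (t : ℕ) (y : Fin N → ℝ) p, |(F ^ t *ᵥ y) p| ≤ C * ρ ^ t * ∑ i, |y i|)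
    (x : ℕ → Fin N → ℝ) (w : ℕ → ℝ) (B : Fin N → ℝ)
    (hx : ∀ t, x (t + 1) = F *ᵥ x t + w t • B) (t : ℕ) (i : Fin N) :
    |x t i| ≤ C * majorant ρ (∑ i, |B i|) (∑ i, |x 0 i|) w t := by
  -- The induction runs over all `F ^ s x_t` at once, because a step in `t` raises `s` by one; the
  -- constant `C` is thus paid only once.
  have key : ∀ t s : ℕ, |(F ^ s *ᵥ x t) i| ≤
      C * ρ ^ s * majorant ρ (∑ i, |B i|) (∑ i, |x 0 i|) w t := by
    intro t
    induction t with
    | zero => exact fun s => hF s (x 0) i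
    | succ t ih =>
      intro s
      have h1 := ih (s + 1)
      have h2 := hF s B i
      rw [hx, Matrix.mulVec_add, Matrix.mulVec_mulVec, ← pow_succ, Matrix.mulVec_smul]
      have h3 : |(F ^ (s + 1) *ᵥ x t + w t • F ^ s *ᵥ B) i| ≤
          |(F ^ (s + 1) *ᵥ x t) i| + |w t| * |(F ^ s *ᵥ B) i| := by
        rw [Pi.add_apply, Pi.smul_apply, smul_eq_mul, ← abs_mul]
        exact abs_add_le _ _
      have h4 := mul_le_mul_of_nonneg_left h2 (abs_nonneg (w t))
      calc _ ≤ _ := h3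
        _ ≤ _ := add_le_add h1 h4
        _ = _ := by rw [majorant]; ring
  simpa using key t 0

/-- Convexity of the square with weights `ρ` and `1 - ρ` at the points `a` and `b / (1 - ρ)`. It
keeps the contraction factor `ρ` for second moments. -/
lemma sq_add_le {ρ : ℝ} (hρ0 : 0 < ρ) (hρ1 : ρ < 1) (a b : ℝ) :
    (ρ * a + b) ^ 2 ≤ ρ * a ^ 2 + b ^ 2 / (1 - ρ) := by
  have h : 0 < 1 - ρ := by linarith
  rw [← sub_nonneg]
  have e : ρ * a ^ 2 + b ^ 2 / (1 - ρ) - (ρ * a + b) ^ 2 =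
      ρ * ((1 - ρ) * a - b) ^ 2 / (1 - ρ) := by
    field_simp
    ring
  rw [e]
  positivity

lemma tendsto_zero_of_geometric_recursion {ρ κ D : ℝ} (hρ0 : 0 < ρ) (hρ1 : ρ < 1) (hκ0 : 0 ≤ κ)
    (hκ1 : κ < 1) (hD : 0 ≤ D) (c : ℕ → ℝ) (hc0 : ∀ t, 0 ≤ c t)
    (hc : ∀ t, c (t + 1) ≤ ρ * c t + D * κ ^ t) : Tendsto c atTop (𝓝 0) := by
  obtain ⟨σ, hσ, hσ1⟩ := exists_between (max_lt hρ1 hκ1)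
  have h1 : ρ < σ := (le_max_left _ _).trans_lt hσ
  have h2 : κ < σ := (le_max_right _ _).trans_lt hσ
  have h3 : 0 < σ - ρ := by linarith
  have hσ0 : 0 < σ := by linarith
  -- `E` is large enough for `E σ ^ t` to dominate both the initial value and the recursion: the
  -- forcing is absorbed by `E (σ - ρ) σ ^ t`.
  set E := c 0 + D / (σ - ρ) with hE
  have hE0 : 0 ≤ D / (σ - ρ) := by positivity
  have hDE : D ≤ E * (σ - ρ) := by
    rw [← div_le_iff₀ h3, hE]
    linarith [hc0 0]
  have hb : ∀ t, c t ≤ E * σ ^ t := by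
    intro t
    induction t with
    | zero => simpa [hE] using hE0
    | succ t ih =>
      have h4 : κ ^ t ≤ σ ^ t := by gcongr
      have h5 : 0 ≤ σ ^ t := by positivity
      calc c (t + 1) ≤ ρ * c t + D * κ ^ t := hc t
        _ ≤ ρ * (E * σ ^ t) + E * (σ - ρ) * σ ^ t := by gcongr; nlinarith [hc0 0]
        _ = E * σ ^ (t + 1) := by ring
  refine squeeze_zero hc0 hb ?_
  have := (tendsto_pow_atTop_nhds_zero_of_lt_one hσ0.le hσ1).const_mul E
  rwa [mul_zero] at this

/-- A stable linear recursion with a geometrically vanishing square integrable input converges to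
zero in mean square. -/
lemma tendsto_integral_mul_of_stable {Ω : Type*} [MeasurableSpace Ω] {P : Measure Ω}
    {N : ℕ} {F : Matrix (Fin N) (Fin N) ℝ} (hF : IsSchurStable F)
    (B : Fin N → ℝ) (x : ℕ → Ω → Fin N → ℝ) (w : ℕ → Ω → ℝ)
    (hx : ∀ t ω, x (t + 1) ω = F *ᵥ x t ω + w t ω • B)
    (hx0 : ∀ i, MemLp (fun ω => x 0 ω i) 2 P) (hw : ∀ t, MemLp (w t) 2 P) {D κ : ℝ}
    (hD : 0 ≤ D) (hκ0 : 0 ≤ κ) (hκ1 : κ < 1) (hwD : ∀ t, ∫ ω, w t ω ^ 2 ∂P ≤ D * κ ^ t) :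
    (∀ t i, MemLp (fun ω => x t ω i) 2 P) ∧
    ∀ i j, Tendsto (fun t => ∫ ω, x t ω i * x t ω j ∂P) atTop (𝓝 0) := by
  have hxL : ∀ t i, MemLp (fun ω => x t ω i) 2 P := by
    intro t
    induction t with
    | zero => exact hx0
    | succ t ih =>
      intro i
      have e : (fun ω => x (t + 1) ω i) = fun ω => ∑ j, F i j * x t ω j + w t ω * B i := by
        funext ω
        rw [hx]
        simp [Matrix.mulVec, dotProduct]
      rw [e]
      exact (memLp_finsetSum _ fun j _ => (ih j).const_mul _).add ((hw t).mul_const _)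
  refine ⟨hxL, fun i j => ?_⟩
  obtain ⟨C, ρ, hC, hρ0, hρ1, hFp⟩ := hF.exists_pow_mulVec_le
  set b := ∑ i, |B i| with hb
  set z : ℕ → Ω → ℝ := fun t ω => majorant ρ b (∑ i, |x 0 ω i|) (fun t => w t ω) t with hz
  have hbound : ∀ t ω i, |x t ω i| ≤ C * z t ω := fun t ω i =>
    abs_le_majorant hFp (fun t => x t ω) (fun t => w t ω) B (fun t => hx t ω) t i
  have hzL : ∀ t, MemLp (z t) 2 P := by
    intro t
    induction t with
    | zero => exact memLp_finsetSum _ fun i _ => (hx0 i).abs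
    | succ t ih => exact (ih.const_mul ρ).add ((hw t).abs.const_mul b)
  have hzt : Tendsto (fun t => ∫ ω, z t ω ^ 2 ∂P) atTop (𝓝 0) := by
    have h1ρ : 0 < 1 - ρ := by linarith
    refine tendsto_zero_of_geometric_recursion (D := b ^ 2 / (1 - ρ) * D) hρ0 hρ1 hκ0 hκ1
      (by positivity) _ (fun t => integral_nonneg fun ω => sq_nonneg _) fun t => ?_
    calc ∫ ω, z (t + 1) ω ^ 2 ∂P
        ≤ ∫ ω, (ρ * z t ω ^ 2 + b ^ 2 / (1 - ρ) * w t ω ^ 2) ∂P := by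
          refine integral_mono (hzL (t + 1)).integrable_sq
            (((hzL t).integrable_sq.const_mul _).add ((hw t).integrable_sq.const_mul _))
            fun ω => ?_
          refine (sq_add_le hρ0 hρ1 _ _).trans (le_of_eq ?_)
          rw [mul_pow, sq_abs]
          ring
      _ = ρ * ∫ ω, z t ω ^ 2 ∂P + b ^ 2 / (1 - ρ) * ∫ ω, w t ω ^ 2 ∂P := by
          rw [integral_add ((hzL t).integrable_sq.const_mul _)
            ((hw t).integrable_sq.const_mul _), integral_const_mul, integral_const_mul]
      _ ≤ ρ * ∫ ω, z t ω ^ 2 ∂P + b ^ 2 / (1 - ρ) * D * κ ^ t := by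
          rw [mul_assoc _ D]
          have := hwD t
          gcongr
  refine squeeze_zero_norm (a := fun t => C ^ 2 * ∫ ω, z t ω ^ 2 ∂P) (fun t => ?_) (by
    simpa using hzt.const_mul (C ^ 2))
  rw [← integral_const_mul]
  refine norm_integral_le_of_norm_le ((hzL t).integrable_sq.const_mul _)
    (Eventually.of_forall fun ω => ?_)
  rw [Real.norm_eq_abs, abs_mul, ← mul_pow, sq]
  exact mul_le_mul (hbound t ω i) (hbound t ω j) (abs_nonneg _)
    ((abs_nonneg _).trans (hbound t ω i))

/-! ### The rate of the estimation error -/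

/-- The mean factor per slot for a coordinate which has the share `β` of the successes. -/
def meanFactor (ε δ β : ℝ) : ℝ := ε + (1 - ε) * δ ^ β

lemma meanFactor_pos {ε δ : ℝ} (hε0 : 0 ≤ ε) (hε1 : ε ≤ 1) (hδ : 0 < δ) (β : ℝ) :
    0 < meanFactor ε δ β := by
  have h1 : 0 < δ ^ β := Real.rpow_pos_of_pos hδ β
  unfold meanFactor
  rcases hε0.eq_or_lt with h | h
  · subst h; linarith
  · have : 0 ≤ (1 - ε) * δ ^ β := mul_nonneg (by linarith) h1.le
    linarith

lemma IsSourceModel.exists_integral_estimate_sub_sq_le {Ω : Type*} [MeasurableSpace Ω]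
    {P : Measure Ω} [IsProbabilityMeasure P] {N : ℕ} [NeZero N] {S₀ : Matrix (Fin N) (Fin N) ℝ}
    {ε : ℝ} {w : ℝ≥0} {x₀ : Ω → Fin N → ℝ} {γ : ℕ → Ω → Bool} {n : ℕ → Ω → ℝ}
    (h : IsSourceModel P S₀ ε w x₀ γ n) (hS : S₀.PosDef) {pow : ℝ} (hpow : 0 < pow) (hw : 0 < w)
    (hε0 : 0 ≤ ε) (hε1 : ε ≤ 1) (q : Fin N → ℕ) (hq : ∀ j, 1 ≤ q j) (j : Fin N) :
    ∃ C : ℝ, 0 ≤ C ∧ ∀ t, ∫ ω, (estimate P pow q x₀ γ n t ω j - x₀ ω j) ^ 2 ∂P ≤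
      C * meanFactor ε ((w : ℝ) / (w + pow)) ((q j : ℝ) / ∑ i, (q i : ℝ)) ^ t := by
  have hw' : (0 : ℝ) < w := hw
  have hs : ∀ j, 0 < S₀.diag j := fun j => hS.diag_pos
  set δ : ℝ := (w : ℝ) / (w + pow) with hδ
  have hδ0 : 0 < δ := by positivity
  have hδ1 : δ ≤ 1 := by rw [hδ, div_le_one (by positivity)]; linarith
  set T : ℝ := ∑ i, (q i : ℝ) with hT
  have hT0 : 0 < T := Finset.sum_pos (fun i _ => by exact_mod_cast hq i) ⟨0, Finset.mem_univ _⟩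
  set β : ℝ := (q j : ℝ) / T with hβ
  have hsj := hs j
  set C : ℝ := S₀.diag j * (1 + w / pow) / δ with hC
  have hC0 : 0 ≤ C := by positivity
  have hexp : 0 ≤ δ ^ (-(q j : ℝ)) := (Real.rpow_pos_of_pos hδ0 _).le
  refine ⟨C * δ ^ (-(q j : ℝ)), by positivity, fun t => ?_⟩
  rw [h.integral_estimate_sub_sq q hS hpow hw, meanFactor,
    ← h.integral_pow_receptions hε0 hε1, ← integral_const_mul]
  refine integral_mono ?_ ?_ fun ω => ?_
  · exact (h.condExp_frozen t (fun g _ => errVar q pow w S₀.diag g t j)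
      (fun g g' hg => by rw [errVar_congr q pow w S₀.diag hg j]) (fun _ => measurable_const)
      fun _ => integrable_const _).1
  · refine Integrable.const_mul ?_ _
    refine (h.condExp_frozen t
      (fun g _ => (δ ^ β) ^ (∑ k ∈ Finset.range t, if g k = true then 1 else 0))
      (fun g g' hg => ?_) (fun _ => measurable_const) fun _ => integrable_const _).1
    rw [Finset.sum_congr rfl fun k hk => by rw [hg k (Finset.mem_range.1 hk)]]
  · set g : ℕ → Bool := fun k => γ k ω with hg
    set S : ℕ := ∑ k ∈ Finset.range t, if γ k ω = true then 1 else 0 with hSdef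
    have h1 : (q j : ℝ) * S ≤ T * successCount q g j t + q j * T := by
      have := quota_mul_sum_le q hq g j t
      rw [hT]
      exact_mod_cast this
    -- The unfinished round costs at most `q j` successes, whence the factor `δ ^ (-q j)` in the
    -- constant.
    have h2 : -(q j : ℝ) + β * S ≤ successCount q g j t := by
      have h3 : β * S * T = q j * S := by rw [hβ]; field_simp
      nlinarith
    have h4 : δ ^ successCount q g j t ≤ δ ^ (-(q j : ℝ)) * (δ ^ β) ^ S := by
      rw [← Real.rpow_natCast, ← Real.rpow_natCast (δ ^ β), ← Real.rpow_mul hδ0.le,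
        ← Real.rpow_add hδ0]
      exact Real.rpow_le_rpow_of_exponent_ge hδ0 hδ1 h2
    refine (errVar_le q hpow hw' hs g t j).trans ?_
    rw [mul_assoc]
    exact mul_le_mul_of_nonneg_left h4 hC0

/-! ### The choice of the quotas -/

/-- Positive weights of sum one are limits of shares of natural numbers. -/
lemma eventually_share {N : ℕ} (a : Fin N → ℝ) (ha : ∀ k, 0 < a k) (hsum : ∑ k, a k = 1)
    (U : Fin N → Set ℝ) (hU : ∀ k, U k ∈ 𝓝 (a k)) :
    ∃ q : Fin N → ℕ, (∀ k, 1 ≤ q k) ∧ ∀ k, (q k : ℝ) / ∑ i, (q i : ℝ) ∈ U k := by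
  -- The quotas are `⌈a k * M⌉₊` for large `M`; rounding up keeps each of them at least one.
  have h1 : ∀ k, Tendsto (fun M : ℕ => (⌈a k * (M : ℝ)⌉₊ : ℝ) / (M : ℝ)) atTop (𝓝 (a k)) :=
    fun k => (tendsto_nat_ceil_mul_div_atTop (ha k).le).comp tendsto_natCast_atTop_atTop
  have h2 : Tendsto (fun M : ℕ => ∑ k, (⌈a k * (M : ℝ)⌉₊ : ℝ) / (M : ℝ)) atTop (𝓝 1) := by
    rw [← hsum]
    exact tendsto_finsetSum _ fun k _ => h1 k
  have h3 : ∀ k, ∀ᶠ M : ℕ in atTop,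
      (⌈a k * (M : ℝ)⌉₊ : ℝ) / (M : ℝ) / ∑ i, (⌈a i * (M : ℝ)⌉₊ : ℝ) / (M : ℝ) ∈ U k := by
    intro k
    have := (h1 k).div h2 one_ne_zero
    rw [div_one] at this
    exact this (hU k)
  obtain ⟨M, hM, hM0⟩ := ((eventually_all.2 h3).and (eventually_gt_atTop 0)).exists
  have hM' : (0 : ℝ) < M := by exact_mod_cast hM0
  refine ⟨fun k => ⌈a k * (M : ℝ)⌉₊, fun k => Nat.one_le_ceil_iff.2 (mul_pos (ha k) hM'),
    fun k => ?_⟩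
  have := hM k
  rwa [← Finset.sum_div, div_div_div_cancel_right₀ hM'.ne'] at this

/-- The logarithmic condition is `l² θ < 1`; its strictness leaves room for a `ρ` above `l`. -/
lemma exists_rate {l θ : ℝ} (hl : 1 ≤ l) (hθ : 0 < θ) (h : Real.log l < -(1 / 2) * Real.log θ) :
    ∃ ρ, l < ρ ∧ ρ ^ 2 * θ < 1 := by
  have h0 : 0 < l := by linarith
  have h1 : l ^ 2 * θ < 1 := by
    rw [← Real.log_neg_iff (by positivity), Real.log_mul (by positivity) hθ.ne', Real.log_pow]
    push_cast
    linarith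
  have h2 : l ^ 2 < 1 / θ := by rwa [lt_div_iff₀ hθ]
  obtain ⟨s, hs1, hs2⟩ := exists_between h2
  refine ⟨√s, Real.lt_sqrt_of_sq_lt hs1, ?_⟩
  rw [Real.sq_sqrt (by nlinarith), ← lt_div_iff₀ hθ]
  exact hs2

/-- A linear functional of `A ^ t y`, for `A` in real Jordan form, in terms of the coordinates. -/
lemma exists_sq_dotProduct_pow_mulVec_le {N d : ℕ} {A : Matrix (Fin N) (Fin N) ℝ}
    {μ : Fin d → ℕ} (e : (Σ i, Fin (μ i)) ≃ Fin N) {ρ : Fin d → ℝ} {C : ℝ}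
    (hC : ∀ (t : ℕ) (y : Fin N → ℝ) i p,
      |(A ^ t *ᵥ y) (e ⟨i, p⟩)| ≤ C * ρ i ^ t * ∑ k, |y (e ⟨i, k⟩)|) (K : Fin N → ℝ) :
    ∃ D : ℝ, 0 ≤ D ∧ ∀ (t : ℕ) (y : Fin N → ℝ),
      (K ⬝ᵥ (A ^ t *ᵥ y)) ^ 2 ≤ D * ∑ k, (ρ (e.symm k).1 ^ 2) ^ t * y k ^ 2 := by
  -- Cauchy–Schwarz is used twice: for the pairing with `K`, and inside a block of at most `N`
  -- coordinates. The other factor `N` counts the coordinates of `A ^ t y`.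
  refine ⟨(∑ k, K k ^ 2) * (N * (C ^ 2 * N)), by positivity, fun t y => ?_⟩
  set Y := ∑ k, (ρ (e.symm k).1 ^ 2) ^ t * y k ^ 2 with hY
  have hcoord : ∀ k, (A ^ t *ᵥ y) k ^ 2 ≤ C ^ 2 * N * Y := by
    intro k
    obtain ⟨⟨i, p⟩, rfl⟩ := e.surjective k
    have h1 : (A ^ t *ᵥ y) (e ⟨i, p⟩) ^ 2 ≤ (C * ρ i ^ t * ∑ k, |y (e ⟨i, k⟩)|) ^ 2 := by
      rw [← sq_abs]
      exact pow_le_pow_left₀ (abs_nonneg _) (hC t y i p) 2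
    have h2 : (∑ k, |y (e ⟨i, k⟩)|) ^ 2 ≤ N * ∑ k, y (e ⟨i, k⟩) ^ 2 := by
      have h3 := sq_sum_le_card_mul_sum_sq (s := Finset.univ) (f := fun k => |y (e ⟨i, k⟩)|)
      simp only [sq_abs, Finset.card_univ, Fintype.card_fin] at h3
      have h4 : μ i ≤ N := by
        have := Fintype.card_congr e
        rw [Fintype.card_sigma] at this
        simp only [Fintype.card_fin] at this
        rw [← this]
        exact Finset.single_le_sum (f := μ) (fun _ _ => Nat.zero_le _) (Finset.mem_univ i)
      refine h3.trans ?_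
      have h5 : (μ i : ℝ) ≤ N := by exact_mod_cast h4
      gcongr
    have h6 : (ρ i ^ 2) ^ t * ∑ k, y (e ⟨i, k⟩) ^ 2 ≤ Y := by
      rw [hY, ← Equiv.sum_comp e, Fintype.sum_sigma, Finset.mul_sum]
      simp only [Equiv.symm_apply_apply]
      exact Finset.single_le_sum
        (f := fun i => ∑ k : Fin (μ i), (ρ i ^ 2) ^ t * y (e ⟨i, k⟩) ^ 2)
        (fun _ _ => by positivity) (Finset.mem_univ i)
    calc _ ≤ _ := h1
      _ = C ^ 2 * (ρ i ^ 2) ^ t * (∑ k, |y (e ⟨i, k⟩)|) ^ 2 := by ring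
      _ ≤ C ^ 2 * (ρ i ^ 2) ^ t * (N * ∑ k, y (e ⟨i, k⟩) ^ 2) := by gcongr
      _ = C ^ 2 * N * ((ρ i ^ 2) ^ t * ∑ k, y (e ⟨i, k⟩) ^ 2) := by ring
      _ ≤ C ^ 2 * N * Y := by gcongr
  calc (K ⬝ᵥ (A ^ t *ᵥ y)) ^ 2 ≤ (∑ k, K k ^ 2) * ∑ k, (A ^ t *ᵥ y) k ^ 2 :=
        Finset.sum_mul_sq_le_sq_mul_sq _ _ _
    _ ≤ (∑ k, K k ^ 2) * ∑ _k : Fin N, C ^ 2 * N * Y := by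
        gcongr
        exact hcoord _
    _ = _ := by simp; ring

end LossyAWGN

end

/-! ### The theorem -/

theorem theorem1
    {N d : ℕ} [NeZero N]
    (A : Matrix (Fin N) (Fin N) ℝ) (B : Fin N → ℝ)
    (lam : Fin d → ℂ) (m : Fin d → ℕ)
    (hm : ∀ i, 1 ≤ m i)
    (hlam : ∀ i, 1 ≤ ‖lam i‖)
    (hanti : Antitone fun i => ‖lam i‖)
    (hdist : ∀ i j, i ≠ j → lam i ≠ lam j ∧ lam i ≠ (starRingEnd ℂ) (lam j))
    (hA : LossyAWGN.IsRealJordanForm A lam m)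
    (hAB : LossyAWGN.IsStabilizable A B)
    (S₀ : Matrix (Fin N) (Fin N) ℝ) (hS₀ : S₀.PosDef)
    (ε : ℝ) (hε0 : 0 ≤ ε) (hε1 : ε ≤ 1)
    (pow : ℝ) (hpow : 0 < pow) (v : ℝ≥0) (hv : 0 < v)
    (α : Fin d → ℝ) (hα : ∀ i, 0 < α i) (hαsum : ∑ i, α i = 1)
    (hcond : ∀ i, Real.log ‖lam i‖ <
      -(1 / 2) * Real.log (ε + (1 - ε) *
        ((v : ℝ) / ((v : ℝ) + pow)) ^ (α i / (LossyAWGN.blockSize (lam i) (m i) : ℝ)))) :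
    ∃ q : Fin N → ℕ, (∀ j, 1 ≤ q j) ∧
      ∀ K : Fin N → ℝ, LossyAWGN.IsSchurStable (A + Matrix.vecMulVec B K) →
      ∀ (Ω : Type*) [MeasurableSpace Ω] (P : Measure Ω) [IsProbabilityMeasure P]
        (x₀ : Ω → Fin N → ℝ) (γ : ℕ → Ω → Bool) (n : ℕ → Ω → ℝ),
        LossyAWGN.IsSourceModel P S₀ ε v x₀ γ n →
        LossyAWGN.MeanSquareStabilized P A B pow x₀ γ n
          (LossyAWGN.state P pow q x₀ γ n A B K)
          (LossyAWGN.channelInput P pow q x₀ γ n)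
          (LossyAWGN.channelOutput P pow q x₀ γ n)
          (LossyAWGN.control P pow q x₀ γ n A B K) := by
  open LossyAWGN in
  have hv' : (0 : ℝ) < v := hv
  set δ : ℝ := (v : ℝ) / ((v : ℝ) + pow) with hδ
  have hδ0 : 0 < δ := by positivity
  have hμ : ∀ i, (0 : ℝ) < blockSize (lam i) (m i) := fun i => by
    have := hm i
    unfold blockSize
    split_ifs <;> · rw [Nat.cast_pos]; omega
  choose ρ hρ1 hρ2 using fun i => exists_rate (hlam i) (meanFactor_pos hε0 hε1 hδ0 _) (hcond i)
  obtain ⟨e, he⟩ := hA.exists_pow_mulVec_le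
  obtain ⟨C, hC0, hC⟩ := he ρ hρ1
  -- The weight `α i` is split evenly among the `μ i` coordinates of its block.
  set a : Fin N → ℝ := fun k =>
    α (e.symm k).1 / (blockSize (lam (e.symm k).1) (m (e.symm k).1) : ℝ) with ha
  have hasum : ∑ k, a k = 1 := by
    rw [← Equiv.sum_comp e, Fintype.sum_sigma, ← hαsum]
    refine Finset.sum_congr rfl fun i _ => ?_
    simp only [ha, Equiv.symm_apply_apply, Finset.sum_const, Finset.card_univ, Fintype.card_fin,
      nsmul_eq_mul]
    exact mul_div_cancel₀ _ (hμ i).ne'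
  obtain ⟨q, hq, hqU⟩ := eventually_share a (fun k => div_pos (hα _) (hμ _)) hasum
    (fun k => {β | ρ (e.symm k).1 ^ 2 * meanFactor ε δ β < 1}) fun k => by
      have hc : Continuous fun β => ρ (e.symm k).1 ^ 2 * meanFactor ε δ β :=
        continuous_const.mul (continuous_const.add
          (continuous_const.mul (Real.continuous_const_rpow hδ0.ne')))
      exact hc.continuousAt.eventually (gt_mem_nhds (hρ2 (e.symm k).1))
  refine ⟨q, hq, fun K hK Ω _ P _ x₀ γ n h => ?_⟩
  set θ : Fin N → ℝ := fun k => meanFactor ε δ ((q k : ℝ) / ∑ i, (q i : ℝ)) with hθ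
  have hθ0 : ∀ k, 0 < θ k := fun k => meanFactor_pos hε0 hε1 hδ0 _
  choose E hE0 hE using fun k => h.exists_integral_estimate_sub_sq_le hS₀ hpow hv hε0 hε1 q hq k
  obtain ⟨D, hD0, hD⟩ := exists_sq_dotProduct_pow_mulVec_le e hC K
  -- The worst coordinate determines a common rate; it is below one because there are finitely many
  -- coordinates.
  obtain ⟨κ, hκ0, hκ1, hκ⟩ : ∃ κ : ℝ, 0 ≤ κ ∧ κ < 1 ∧ ∀ k, ρ (e.symm k).1 ^ 2 * θ k ≤ κ := by
    refine ⟨Finset.univ.sup' ⟨0, Finset.mem_univ _⟩ fun k => ρ (e.symm k).1 ^ 2 * θ k, ?_, ?_,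
      fun k => Finset.le_sup' (fun k => ρ (e.symm k).1 ^ 2 * θ k) (Finset.mem_univ k)⟩
    · exact (mul_nonneg (sq_nonneg _) (hθ0 0).le).trans
        (Finset.le_sup' (fun k => ρ (e.symm k).1 ^ 2 * θ k) (Finset.mem_univ 0))
    · exact (Finset.sup'_lt_iff _).2 fun k _ => hqU k
  have herr := fun t k => h.memLp_estimate_sub q hS₀ hpow hv t k
  have hu := h.isUncorrelated hS₀
  have hwL : ∀ t, MemLp (loopNoise q γ P pow x₀ n A K t) 2 P := fun t => by
    have hsum : loopNoise q γ P pow x₀ n A K t = fun ω => ∑ i, K i *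
        ∑ j, (A ^ t) i j * (estimate P pow q x₀ γ n (t + 1) ω j - x₀ ω j) := rfl
    rw [hsum]
    exact memLp_finsetSum _ fun i _ => (memLp_finsetSum _ fun j _ =>
      (herr (t + 1) j).const_mul _).const_mul _
  have hwD : ∀ t, ∫ ω, loopNoise q γ P pow x₀ n A K t ω ^ 2 ∂P ≤
      (D * ∑ k, E k * θ k) * κ ^ t := by
    intro t
    calc ∫ ω, loopNoise q γ P pow x₀ n A K t ω ^ 2 ∂P
        ≤ ∫ ω, D * ∑ k, (ρ (e.symm k).1 ^ 2) ^ t *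
            (estimate P pow q x₀ γ n (t + 1) ω k - x₀ ω k) ^ 2 ∂P :=
          integral_mono (hwL t).integrable_sq
            ((integrable_finsetSum _ fun k _ =>
              (herr (t + 1) k).integrable_sq.const_mul _).const_mul _) fun ω => hD t _
      _ = D * ∑ k, (ρ (e.symm k).1 ^ 2) ^ t *
            ∫ ω, (estimate P pow q x₀ γ n (t + 1) ω k - x₀ ω k) ^ 2 ∂P := by
          rw [integral_const_mul, integral_finsetSum _ fun k _ =>
            (herr (t + 1) k).integrable_sq.const_mul _]
          simp only [integral_const_mul]
      _ ≤ D * ∑ k, E k * θ k * κ ^ t := by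
          refine mul_le_mul_of_nonneg_left (Finset.sum_le_sum fun k _ => ?_) hD0
          -- The control at `t` uses the estimate after slot `t`, hence the exponent `t + 1`; the
          -- extra `θ k` goes into the constant.
          calc _ ≤ (ρ (e.symm k).1 ^ 2) ^ t * (E k * θ k ^ (t + 1)) :=
                mul_le_mul_of_nonneg_left (hE k (t + 1)) (by positivity)
            _ = E k * θ k * (ρ (e.symm k).1 ^ 2 * θ k) ^ t := by rw [mul_pow]; ring
            _ ≤ E k * θ k * κ ^ t := by
                refine mul_le_mul_of_nonneg_left (pow_le_pow_left₀ ?_ (hκ k) t)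
                  (mul_nonneg (hE0 k) (hθ0 k).le)
                exact mul_nonneg (sq_nonneg _) (hθ0 k).le
      _ = _ := by rw [← Finset.sum_mul]; ring
  obtain ⟨hL, hlim⟩ := tendsto_integral_mul_of_stable hK B
    (LossyAWGN.state P pow q x₀ γ n A B K) (loopNoise q γ P pow x₀ n A K)
    (fun t ω => state_succ q γ P pow x₀ n A B K t ω) hu.memLp_init hwL
    (mul_nonneg hD0 (Finset.sum_nonneg fun k _ => mul_nonneg (hE0 k) (hθ0 k).le)) hκ0 hκ1 hwD
  exact {
    init := rfl
    plant := fun _ _ => rfl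
    channel := fun _ _ => rfl
    encoder_causal := measurable_channelInput q γ P pow x₀ n A B K
    decoder_causal := measurable_control q γ P pow x₀ n A B K
    memLp_input := h.memLp_channelInput q hS₀ hpow hv
    power := fun t => (h.integral_channelInput_sq q hS₀ hpow hv t).le
    memLp_state := hL
    tendsto := hlim }
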